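/- Let $p\ge 1$ be an integer and let $L\subset\mathbb C$ be a simple closed contour with a regular parametrization of class $C^p$ (for instance any $C^\infty$ regular simple closed curve), traversed in the positive direction. Let $D^+$ be the domain inside $L$, and let $G\subset\mathbb C$ be any set with $L\cup D^+\subseteq G$; a function is called analytic in $G$ if it is complex analytic in a neighbourhood of every point of $G$. For $t\in L$ and $1\le k\le p$ the (hyper)singular integral $\int_L \frac{x(\tau)\,d\tau}{(\tau-t)^k}$ is understood in the Cauchy–Hadamard sense, i.e. as the limit $$\lim_{v\to 0+}\Big[\int_{\{\tau\in L:\,|\tau-t|>v\}}\frac{x(\tau)\,d\tau}{(\tau-t)^k}+\frac{\xi(v)}{v^{k-1}}\Big],$$ where $\xi$ is a polynomial of degree less than $k-1$ chosen so that the limit exists (for $k=1$, $\xi=0$ and this is the Cauchy principal value). Let $\pounds$ be an arbitrary (in general nonlinear) operator that takes $p+1$ complex functions on $L$ to a complex function on $L$, and let $f:L\to\mathbb C$. Consider the nonlinear hypersingular integral equation $$\pounds\Big(\frac1{\pi i}\int_L\frac{x(\tau)\,d\tau}{(\tau-t)^p},\ \frac1{\pi i}\int_L\frac{x(\tau)\,d\tau}{(\tau-t)^{p-1}},\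 \dots,\ \frac1{\pi i}\int_L\frac{x(\tau)\,d\tau}{\tau-t},\ x(t)\Big)=f(t),\qquad t\in L,\tag{1}$$ where being a solution includes the existence of all the integrals at every $t\in L$, and the nonlinear differential equation $$\pounds_1\big(x^{(p-1)}(t),\dots,x'(t),x(t)\big)=f(t),\qquad t\in L,\tag{2}$$ where the operator $\pounds_1$ is obtained from $\pounds$ by replacing each hypersingular operator with the corresponding derivative divided by a factorial: $$\pounds_1(y_{p-1},\dots,y_1,y_0)=\pounds\Big(\frac{y_{p-1}}{(p-1)!},\ \dots,\ \frac{y_1}{1!},\ y_0,\ y_0\Big).$$ Then the solutions of (1) that are analytic in $G$ are exactly the solutions of (2) that are analytic in $G$. -/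

import Mathlib

open Set Filter Topology MeasureTheory

/-- `γ : ℝ → ℂ` is a one-periodic regular parametrization of class `C^n` of a simple closed
contour (the contour itself is `Set.range γ`). -/
structure IsSmoothClosedContour (n : ℕ) (γ : ℝ → ℂ) : Prop where
  periodic : Function.Periodic γ 1
  contDiff : ContDiff ℝ n γ
  deriv_ne_zero : ∀ s, deriv γ s ≠ 0
  injOn : Set.InjOn γ (Set.Ico 0 1)

/-- The inner domain `D⁺` of the contour: the points off the contour whose connected component in
the complement of the contour is bounded. -/
def innerDomain (γ : ℝ → ℂ) : Set ℂ :=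
  {z | z ∈ (Set.range γ)ᶜ ∧ Bornology.IsBounded (connectedComponentIn (Set.range γ)ᶜ z)}

/-- The contour is traversed in the positive direction: it winds exactly once, counterclockwise,
around every point of its inner domain. -/
def IsPositivelyOriented (γ : ℝ → ℂ) : Prop :=
  ∀ z ∈ innerDomain γ, ∫ s in (0 : ℝ)..1, deriv γ s / (γ s - z) = 2 * Real.pi * Complex.I

/-- The integral of `φ(τ) / (τ - t)^p dτ` over the part of the contour that remains after the part
in the closed disc of radius `v` about `t` is removed. -/
noncomputable def truncatedIntegral (γ : ℝ → ℂ) (φ : ℂ → ℂ) (p : ℕ) (t : ℂ) (v : ℝ) : ℂ :=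
  ∫ s in {s : ℝ | s ∈ Set.Ioc 0 1 ∧ v < ‖γ s - t‖}, φ (γ s) / (γ s - t) ^ p * deriv γ s

/-- The hypersingular integral of `φ(τ) / (τ - t)^p dτ` over the contour exists in the
Cauchy-Hadamard sense and is equal to `A`: after adding a suitable `ξ(v) / v^(p-1)`, the truncated
integrals tend to `A` as `v → 0+`. Here `ξ` is a polynomial of degree less than `p - 1`, so that
only the negative powers `v^(-1), …, v^(-(p-1))` are removed and no finite amount is added. For
`p = 1` this forces `ξ = 0` and the value is the Cauchy principal value. -/
def HasHypersingularIntegral (γ : ℝ → ℂ) (φ : ℂ → ℂ) (p : ℕ) (t A : ℂ) : Prop :=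
  ∃ ξ : Polynomial ℂ, ξ.degree < ((p - 1 : ℕ) : WithBot ℕ) ∧
    Tendsto (fun v : ℝ => truncatedIntegral γ φ p t v + ξ.eval (v : ℂ) / (v : ℂ) ^ (p - 1))
      (𝓝[>] 0) (𝓝 A)

/-- The value of a hypersingular integral is unique. -/
theorem HasHypersingularIntegral.unique {γ : ℝ → ℂ} {φ : ℂ → ℂ} {p : ℕ} {t A B : ℂ}
    (hA : HasHypersingularIntegral γ φ p t A) (hB : HasHypersingularIntegral γ φ p t B) :
    A = B := by
  obtain ⟨ξ, hξ, h1⟩ := hA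
  obtain ⟨η, hη, h2⟩ := hB
  have hdeg : (ξ - η).degree < ((p - 1 : ℕ) : WithBot ℕ) :=
    lt_of_le_of_lt (Polynomial.degree_sub_le ξ η) (max_lt hξ hη)
  have h3 : Tendsto (fun v : ℝ => (ξ - η).eval (v : ℂ) / (v : ℂ) ^ (p - 1)) (𝓝[>] 0)
      (𝓝 (A - B)) := by
    refine (h1.sub h2).congr fun v => ?_
    rw [Polynomial.eval_sub, sub_div]
    ring
  generalize ξ - η = q at hdeg h3
  generalize p - 1 = m at hdeg h3
  have hv : Tendsto (fun v : ℝ => (v : ℂ)) (𝓝[>] 0) (𝓝 0) := by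
    have := (Complex.continuous_ofReal.tendsto 0).mono_left (nhdsWithin_le_nhds (s := Set.Ioi 0))
    simpa using this
  by_cases hq : q = 0
  · subst hq
    simp only [Polynomial.eval_zero, zero_div] at h3
    exact (sub_eq_zero.1 (tendsto_nhds_unique h3 tendsto_const_nhds))
  · exfalso
    obtain ⟨g, hg, hnd⟩ := Polynomial.exists_eq_pow_rootMultiplicity_mul_and_not_dvd q hq 0
    set r := q.rootMultiplicity 0
    have hg0 : g.eval 0 ≠ 0 := fun h => hnd (Polynomial.dvd_iff_isRoot.2 h)
    have hr : r < m := by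
      have h4 : (r : WithBot ℕ) ≤ q.degree := by
        have h := Polynomial.degree_le_of_dvd (Polynomial.pow_rootMultiplicity_dvd q 0) hq
        simpa using h
      exact_mod_cast lt_of_le_of_lt h4 hdeg
    have h5 : Tendsto (fun v : ℝ => (v : ℂ) ^ (m - r) * (q.eval (v : ℂ) / (v : ℂ) ^ m)) (𝓝[>] 0)
        (𝓝 (0 ^ (m - r) * (A - B))) := (hv.pow _).mul h3
    rw [zero_pow (by omega), zero_mul] at h5
    have h6 : Tendsto (fun v : ℝ => g.eval (v : ℂ)) (𝓝[>] 0) (𝓝 (g.eval 0)) :=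
      (g.continuous.tendsto 0).comp hv
    refine hg0 (tendsto_nhds_unique (h6.congr' ?_) h5)
    filter_upwards [self_mem_nhdsWithin] with v hv0
    have hne : (v : ℂ) ≠ 0 := by
      exact_mod_cast (ne_of_gt hv0)
    have h7 : q.eval (v : ℂ) = (v : ℂ) ^ r * g.eval (v : ℂ) := by
      conv_lhs => rw [hg]
      simp
    have h8 : (v : ℂ) ^ m = (v : ℂ) ^ (m - r) * (v : ℂ) ^ r := by
      rw [← pow_add]; congr 1; omega
    rw [h7, h8]
    field_simp

/-- `x` solves the nonlinear hypersingular equation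
`F ((1/πi) ∫ x(τ)/(τ-t)^p dτ, …, (1/πi) ∫ x(τ)/(τ-t) dτ, x) = f` on the contour: all the
hypersingular integrals exist at every point `t` of the contour, and the equation holds. `F` is an
operator on functions on the contour; slot `j` of its first argument takes the integral of
order `j + 1`, and its second argument takes `x` itself. -/
def SolvesHypersingularEq {p : ℕ} (γ : ℝ → ℂ)
    (F : (Fin p → Set.range γ → ℂ) → (Set.range γ → ℂ) → (Set.range γ → ℂ))
    (f : Set.range γ → ℂ) (x : ℂ → ℂ) : Prop :=
  ∃ I : Fin p → Set.range γ → ℂ,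
    (∀ (j : Fin p) (t : Set.range γ), HasHypersingularIntegral γ x (j + 1) t (I j t)) ∧
    F (fun j t => 1 / (Real.pi * Complex.I) * I j t) (fun t => x t) = f

/-- The operator `F₁`, a function of `(y₀, …, y_{p-1})` (in the places of `x, x', …, x^(p-1)`),
obtained from `F` by putting `y_j / j!` in the place of the hypersingular integral of
order `j + 1` and `y₀` in the place of `x`. -/
noncomputable def differentialOperator {p : ℕ} [NeZero p] {L : Set ℂ}
    (F : (Fin p → L → ℂ) → (L → ℂ) → (L → ℂ)) (y : Fin p → L → ℂ) : L → ℂ :=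
  F (fun j t => y j t / (Nat.factorial j : ℂ)) (y 0)

/-- `x` solves the differential equation `F₁ (x, x', …, x^(p-1)) = f` on `L`, with complex
derivatives of `x`. -/
def SolvesDifferentialEq {p : ℕ} {L : Set ℂ} (F₁ : (Fin p → L → ℂ) → (L → ℂ)) (f : L → ℂ)
    (x : ℂ → ℂ) : Prop :=
  F₁ (fun j t => iteratedDeriv j x t) = f

open Asymptotics

/-! If `x` is analytic on the contour and inside it, its hypersingular integral of order k + 1 at
`t` equals πi x^(k)(t)/k!. Since Cauchy–Hadamard values are unique, both equations then feed the
same functions to the operator, and nothing about the operator is needed.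

The formula is proved by induction on k (`hasHypersingularIntegral_zero`). Write x(τ) = x(t) + (τ -
t) y(τ) with y = `dslope x t`, again holomorphic. The second term is an integral of y of one order
less. After k divisions the value at `t` is the k-th Taylor coefficient
(`iterate_dslope_apply_self`).

Three facts remain. The regular integral left over at order one vanishes by Cauchy's theorem, in the
winding number form `integral_dslope_eq_zero`, so the Jordan curve theorem is avoided. The kernel
1/(τ - t) has principal value πi (`tendsto_truncated_inv`): it is the midpoint of the limits of the
winding integral from the two sides of the contour, which are 2πi and 0. The kernels of order n + 1
≥ 2 have finite part 0 (`exists_polynomial_tendsto_integral_inv_pow`): their primitive is evaluated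
at two points at the same distance v from `t`, and in the expansions by signed distance the constant
terms cancel. -/

/-! ### Integrals of Cauchy type -/

theorem exists_pos_le_norm_sub {γ : ℝ → ℂ} (hγ : Continuous γ) {a b : ℝ} {z : ℂ}
    (hz : ∀ s ∈ Icc a b, γ s ≠ z) : ∃ r > 0, ∀ s ∈ Icc a b, r ≤ ‖γ s - z‖ := by
  rcases (Icc a b).eq_empty_or_nonempty with h | h
  · exact ⟨1, one_pos, by simp [h]⟩
  obtain ⟨s₀, hs₀, hmin⟩ := isCompact_Icc.exists_isMinOn h
    (f := fun s => ‖γ s - z‖) (by fun_prop)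
  exact ⟨‖γ s₀ - z‖, norm_pos_iff.2 (sub_ne_zero.2 (hz s₀ hs₀)), fun s hs => hmin hs⟩

theorem exists_pos_norm_le_of_continuous {c : ℝ → ℂ} (hc : Continuous c) (a b : ℝ) :
    ∃ M > 0, ∀ s ∈ Icc a b, ‖c s‖ ≤ M := by
  obtain ⟨M, hM⟩ := isCompact_Icc.exists_bound_of_continuousOn (s := Icc a b) hc.continuousOn
  exact ⟨max M 1, by positivity, fun s hs => (hM s hs).trans (le_max_left _ _)⟩

/-- An integral of Cauchy type is holomorphic off the curve. -/
theorem hasDerivAt_cauchyTypeIntegral {c γ : ℝ → ℂ} (hc : Continuous c) (hγ : Continuous γ)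
    {a b : ℝ} (hab : a ≤ b) {z : ℂ} (hz : ∀ s ∈ Icc a b, γ s ≠ z) :
    HasDerivAt (fun w => ∫ s in a..b, c s / (γ s - w)) (∫ s in a..b, c s / (γ s - z) ^ 2) z := by
  obtain ⟨r, hr, hrz⟩ := exists_pos_le_norm_sub hγ hz
  obtain ⟨M, hM, hcM⟩ := exists_pos_norm_le_of_continuous hc a b
  have hball : ∀ w ∈ Metric.ball z (r / 2), ∀ s ∈ Icc a b, r / 2 ≤ ‖γ s - w‖ := by
    intro w hw s hs
    have h1 := hrz s hs
    rw [Metric.mem_ball, dist_eq_norm] at hw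
    have h2 : ‖γ s - z‖ ≤ ‖γ s - w‖ + ‖w - z‖ := by
      simpa using norm_add_le (γ s - w) (w - z)
    linarith
  have hne : ∀ w ∈ Metric.ball z (r / 2), ∀ s ∈ Icc a b, γ s - w ≠ 0 := fun w hw s hs =>
    norm_pos_iff.1 (lt_of_lt_of_le (by positivity) (hball w hw s hs))
  have hmeas : ∀ w : ℂ, Measurable fun s => c s / (γ s - w) := fun w =>
    hc.measurable.div (hγ.measurable.sub_const w)
  have hz0 : z ∈ Metric.ball z (r / 2) := Metric.mem_ball_self (by positivity)
  refine (intervalIntegral.hasDerivAt_integral_of_dominated_loc_of_deriv_le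
    (F := fun w s => c s / (γ s - w)) (F' := fun w s => c s / (γ s - w) ^ 2)
    (bound := fun _ => M / (r / 2) ^ 2) (s := Metric.ball z (r / 2))
    (Metric.ball_mem_nhds z (by positivity)) ?_ ?_ ?_ ?_ ?_ ?_).2
  · exact Eventually.of_forall fun w => (hmeas w).aestronglyMeasurable
  · refine ContinuousOn.intervalIntegrable ?_
    rw [uIcc_of_le hab]
    exact hc.continuousOn.div (by fun_prop) (hne z hz0)
  · exact (hc.measurable.div ((hγ.measurable.sub_const z).pow_const 2)).aestronglyMeasurable
  · refine Eventually.of_forall fun s hs w hw => ?_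
    have hs' : s ∈ Icc a b := by
      rw [uIoc_of_le hab] at hs; exact Ioc_subset_Icc_self hs
    rw [norm_div, norm_pow]
    have := hball w hw s hs'
    gcongr
    exact hcM s hs'
  · exact intervalIntegrable_const
  · refine Eventually.of_forall fun s hs w hw => ?_
    have hs' : s ∈ Icc a b := by
      rw [uIoc_of_le hab] at hs; exact Ioc_subset_Icc_self hs
    have h := ((hasDerivAt_const w (γ s)).sub (hasDerivAt_id w)).fun_inv (hne w hw s hs')
    have h' := h.const_mul (c s)
    refine (h'.congr_deriv ?_).congr_of_eventuallyEq ?_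
    · simp [div_eq_mul_inv]
    · exact Eventually.of_forall fun w => by simp [div_eq_mul_inv]

theorem tendsto_cauchyTypeIntegral_cocompact {c γ : ℝ → ℂ} (hc : Continuous c) (hγ : Continuous γ)
    {a b : ℝ} (hab : a ≤ b) :
    Tendsto (fun w => ∫ s in a..b, c s / (γ s - w)) (cocompact ℂ) (𝓝 0) := by
  obtain ⟨M, hM, hcM⟩ := exists_pos_norm_le_of_continuous hc a b
  obtain ⟨R, hR, hγR⟩ := exists_pos_norm_le_of_continuous hγ a b
  have h1 : Tendsto (fun w : ℂ => ‖w‖ - R) (cocompact ℂ) atTop :=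
    tendsto_atTop_add_const_right _ _ (tendsto_norm_cocompact_atTop (E := ℂ))
  have h2 : Tendsto (fun w : ℂ => M / (‖w‖ - R) * |b - a|) (cocompact ℂ) (𝓝 0) := by
    simpa using (h1.const_div_atTop M).mul_const |b - a|
  refine squeeze_zero_norm' ?_ h2
  filter_upwards [h1.eventually_gt_atTop 0] with w hw
  refine intervalIntegral.norm_integral_le_of_norm_le_const fun s hs => ?_
  have hs' : s ∈ Icc a b := by
    rw [uIoc_of_le hab] at hs; exact Ioc_subset_Icc_self hs
  rw [norm_div]
  have h3 : ‖w‖ - R ≤ ‖γ s - w‖ := by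
    have := norm_sub_norm_le w (γ s)
    rw [norm_sub_rev] at this
    linarith [hγR s hs']
  gcongr
  exact hcM s hs'

namespace IsSmoothClosedContour

variable {n : ℕ} {γ : ℝ → ℂ}

theorem mono (h : IsSmoothClosedContour n γ) {m : ℕ} (hm : m ≤ n) :
    IsSmoothClosedContour m γ :=
  ⟨h.periodic, h.contDiff.of_le (by exact_mod_cast hm), h.deriv_ne_zero, h.injOn⟩

theorem continuous (h : IsSmoothClosedContour n γ) : Continuous γ := h.contDiff.continuous

theorem continuous_deriv (h : IsSmoothClosedContour 1 γ) : Continuous (deriv γ) :=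
  h.contDiff.continuous_deriv (by norm_num)

theorem hasDerivAt (h : IsSmoothClosedContour 1 γ) (s : ℝ) : HasDerivAt γ (deriv γ s) s :=
  (h.contDiff.differentiable (by norm_num) s).hasDerivAt

theorem range_eq (h : IsSmoothClosedContour n γ) : range γ = γ '' Icc 0 1 := by
  have := h.periodic.image_Icc one_pos 0
  rw [← this, zero_add]

theorem isClosed_range (h : IsSmoothClosedContour n γ) : IsClosed (range γ) := by
  rw [h.range_eq]
  exact (isCompact_Icc.image h.continuous).isClosed

end IsSmoothClosedContour

/-! ### Winding numbers -/

/-- `2πi` times the winding number of the curve `γ` about `z`. -/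
noncomputable def windingIntegral (γ : ℝ → ℂ) (z : ℂ) : ℂ :=
  ∫ s in (0 : ℝ)..1, deriv γ s / (γ s - z)

namespace IsSmoothClosedContour

variable {γ : ℝ → ℂ}

/-- The differentiated integrand has the primitive `-(γ s - z)⁻¹`, whose end values agree by
periodicity. -/
theorem hasDerivAt_windingIntegral (h : IsSmoothClosedContour 1 γ) {z : ℂ} (hz : z ∉ range γ) :
    HasDerivAt (windingIntegral γ) 0 z := by
  have hne : ∀ s, γ s ≠ z := fun s hs => hz ⟨s, hs⟩
  refine (hasDerivAt_cauchyTypeIntegral h.continuous_deriv h.continuous zero_le_one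
    fun s _ => hne s).congr_deriv ?_
  have hprim : ∀ s ∈ uIcc (0 : ℝ) 1,
      HasDerivAt (fun s => -(γ s - z)⁻¹) (deriv γ s / (γ s - z) ^ 2) s := by
    intro s _
    refine (((h.hasDerivAt s).sub_const z).fun_inv (sub_ne_zero.2 (hne s))).neg.congr_deriv ?_
    ring
  rw [intervalIntegral.integral_eq_sub_of_hasDerivAt hprim]
  · have := h.periodic 0
    rw [zero_add] at this
    simp [this]
  · refine (Continuous.div h.continuous_deriv ((h.continuous.sub continuous_const).pow 2)
      fun s => pow_ne_zero 2 (sub_ne_zero.2 (hne s))).intervalIntegrable _ _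

theorem windingIntegral_eq_of_mem_connectedComponentIn (h : IsSmoothClosedContour 1 γ) {z w : ℂ}
    (hz : z ∈ (range γ)ᶜ) (hw : w ∈ connectedComponentIn (range γ)ᶜ z) :
    windingIntegral γ w = windingIntegral γ z := by
  have hsub := connectedComponentIn_subset (range γ)ᶜ z
  refine IsOpen.is_const_of_deriv_eq_zero (𝕜 := ℂ)
    (h.isClosed_range.isOpen_compl.connectedComponentIn) isPreconnected_connectedComponentIn
    (fun y hy => (h.hasDerivAt_windingIntegral
      (hsub hy)).differentiableAt.differentiableWithinAt)
    (fun y hy => (h.hasDerivAt_windingIntegral (hsub hy)).deriv) hw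
    (mem_connectedComponentIn hz)

/-- The winding integral is constant on the component and tends to 0 at infinity, so a nonzero
constant would confine the component to a bounded set. -/
theorem windingIntegral_eq_zero_of_not_isBounded (h : IsSmoothClosedContour 1 γ) {z : ℂ}
    (hz : z ∈ (range γ)ᶜ)
    (hb : ¬ Bornology.IsBounded (connectedComponentIn (range γ)ᶜ z)) :
    windingIntegral γ z = 0 := by
  have ht : Tendsto (windingIntegral γ) (cocompact ℂ) (𝓝 0) :=
    tendsto_cauchyTypeIntegral_cocompact h.continuous_deriv h.continuous zero_le_one
  by_contra hne
  have hev := ht.eventually (isOpen_ne.mem_nhds (Ne.symm hne))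
  rw [← Metric.cobounded_eq_cocompact] at hev
  refine hb ((Bornology.isBounded_def.2 ?_ ))
  filter_upwards [hev] with w hw hmem
  exact hw (h.windingIntegral_eq_of_mem_connectedComponentIn hz hmem)

/-- The outward ray from a far point misses the contour, so the component of that point is
unbounded. This gives the decay at infinity of Dixon's function. -/
theorem eventually_windingIntegral_eq_zero (h : IsSmoothClosedContour 1 γ) :
    ∀ᶠ z in cocompact ℂ, z ∉ range γ ∧ windingIntegral γ z = 0 := by
  obtain ⟨R, hR, hγR⟩ := exists_pos_norm_le_of_continuous h.continuous 0 1
  filter_upwards [(tendsto_norm_cocompact_atTop (E := ℂ)).eventually_gt_atTop R] with z hz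
  have hray : (fun r : ℝ => (r : ℂ) * z) '' Ici 1 ⊆ (range γ)ᶜ := by
    rintro _ ⟨r, hr, rfl⟩ hmem
    rw [h.range_eq] at hmem
    obtain ⟨s, hs, hse⟩ := hmem
    have h1 := hγR s hs
    rw [hse, norm_mul, Complex.norm_real, Real.norm_of_nonneg (zero_le_one.trans hr)] at h1
    have : (1 : ℝ) ≤ r := hr
    nlinarith
  have hz1 : z ∈ (fun r : ℝ => (r : ℂ) * z) '' Ici 1 := ⟨1, mem_Ici.2 le_rfl, by simp⟩
  refine ⟨hray hz1, h.windingIntegral_eq_zero_of_not_isBounded (hray hz1) fun hb => ?_⟩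
  obtain ⟨C, hC⟩ := (hb.subset ((isPreconnected_Ici.image _
    (by fun_prop)).subset_connectedComponentIn hz1 hray)).exists_norm_le
  have hz0 : 0 < ‖z‖ := hR.trans hz
  have h2 := hC _ ⟨max 1 ((C + 1) / ‖z‖), mem_Ici.2 (le_max_left _ _), rfl⟩
  simp only [norm_mul, Complex.norm_real] at h2
  rw [Real.norm_of_nonneg (zero_le_one.trans (le_max_left _ _))] at h2
  have h3 : (C + 1) / ‖z‖ * ‖z‖ ≤ max 1 ((C + 1) / ‖z‖) * ‖z‖ := by
    gcongr; exact le_max_right _ _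
  rw [div_mul_cancel₀ _ hz0.ne'] at h3
  linarith

theorem windingIntegral_eq_zero (h : IsSmoothClosedContour 1 γ) {z : ℂ}
    (hz : z ∉ range γ ∪ innerDomain γ) : windingIntegral γ z = 0 := by
  rw [mem_union, not_or] at hz
  exact h.windingIntegral_eq_zero_of_not_isBounded hz.1 fun hb => hz.2 ⟨hz.1, hb⟩

theorem windingIntegral_mem (h : IsSmoothClosedContour 1 γ) (ho : IsPositivelyOriented γ) {z : ℂ}
    (hz : z ∉ range γ) : windingIntegral γ z ∈ ({0, 2 * Real.pi * Complex.I} : Set ℂ) := by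
  by_cases hi : z ∈ innerDomain γ
  · exact Or.inr (ho z hi)
  · exact Or.inl (h.windingIntegral_eq_zero fun hu => hu.elim hz hi)

end IsSmoothClosedContour

/-! ### Divided differences and Cauchy's theorem -/

theorem dslope_comm {𝕜 : Type*} [NontriviallyNormedField 𝕜] (f : 𝕜 → 𝕜) (a b : 𝕜) :
    dslope f a b = dslope f b a := by
  rcases eq_or_ne a b with rfl | h
  · rfl
  · rw [dslope_of_ne f h.symm, dslope_of_ne f h, slope_comm]

/-- Near the diagonal the mean value inequality on a convex ball bounds the quotient; away from it
the denominator is at least R/2. -/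
theorem exists_norm_dslope_le {U : Set ℂ} (hU : IsOpen U) {h : ℂ → ℂ} (hh : DifferentiableOn ℂ h U)
    {K : Set ℂ} (hK : IsCompact K) (hKU : K ⊆ U) {z₀ : ℂ} (hz₀ : z₀ ∈ U) :
    ∃ r > 0, Metric.ball z₀ r ⊆ U ∧
      ∃ B, ∀ z ∈ Metric.ball z₀ r, ∀ w ∈ K, ‖dslope h z w‖ ≤ B := by
  obtain ⟨R, hR, hRU⟩ := Metric.nhds_basis_closedBall.mem_iff.1 (hU.mem_nhds hz₀)
  obtain ⟨C, hC⟩ := (isCompact_closedBall z₀ R).exists_bound_of_continuousOn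
    (((hh.deriv hU).continuousOn).mono hRU)
  obtain ⟨M₁, hM₁⟩ := hK.exists_bound_of_continuousOn (hh.continuousOn.mono hKU)
  obtain ⟨M₂, hM₂⟩ := (isCompact_closedBall z₀ R).exists_bound_of_continuousOn
    (hh.continuousOn.mono hRU)
  have hsub : Metric.ball z₀ (R / 2) ⊆ Metric.closedBall z₀ R :=
    (Metric.ball_subset_ball (by linarith)).trans Metric.ball_subset_closedBall
  refine ⟨R / 2, by positivity, hsub.trans hRU, max C ((M₁ + M₂) / (R / 2)), ?_⟩
  intro z hz w hw
  by_cases hwR : w ∈ Metric.closedBall z₀ R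
  · refine le_trans ?_ (le_max_left _ _)
    rcases eq_or_ne w z with rfl | hne
    · rw [dslope_same]; exact hC _ hwR
    · rw [dslope_of_ne _ hne, slope_def_field, norm_div,
        div_le_iff₀ (norm_pos_iff.2 (sub_ne_zero.2 hne))]
      exact (convex_closedBall z₀ R).norm_image_sub_le_of_norm_deriv_le
        (fun y hy => hh.differentiableAt (hU.mem_nhds (hRU hy))) hC (hsub hz) hwR
  · refine le_trans ?_ (le_max_right _ _)
    rw [Metric.mem_closedBall, not_le, dist_eq_norm] at hwR
    have hz' := hz
    rw [Metric.mem_ball, dist_eq_norm] at hz'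
    have h1 : ‖w - z₀‖ ≤ ‖w - z‖ + ‖z - z₀‖ := by
      simpa using norm_add_le (w - z) (z - z₀)
    have h2 : R / 2 ≤ ‖w - z‖ := by linarith
    have hne : w ≠ z := by
      rintro rfl
      simp at h2; linarith
    rw [dslope_of_ne _ hne, slope_def_field, norm_div]
    have h3 : ‖h w - h z‖ ≤ M₁ + M₂ :=
      (norm_sub_le _ _).trans (add_le_add (hM₁ w hw) (hM₂ z (hsub hz)))
    have h4 := (norm_nonneg _).trans h3
    gcongr

theorem continuousOn_dslope_comp {U : Set ℂ} (hU : IsOpen U) {h : ℂ → ℂ}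
    (hh : DifferentiableOn ℂ h U) {γ : ℝ → ℂ} (hγ : Continuous γ) {a b : ℝ}
    (hγU : ∀ s ∈ Icc a b, γ s ∈ U) {z : ℂ} (hz : z ∈ U) :
    ContinuousOn (fun s => dslope h z (γ s)) (Icc a b) :=
  ((continuousOn_dslope (hU.mem_nhds hz)).2
    ⟨hh.continuousOn, hh.differentiableAt (hU.mem_nhds hz)⟩).comp hγ.continuousOn hγU

/-- Differentiation under the integral sign. The derivative in `z` is dominated through Cauchy's
estimate on circles of radius r/2, from the uniform bound on `dslope`. -/
theorem differentiableAt_integral_dslope {U : Set ℂ} (hU : IsOpen U) {h : ℂ → ℂ}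
    (hh : DifferentiableOn ℂ h U) {c γ : ℝ → ℂ} (hc : Continuous c) (hγ : Continuous γ)
    {a b : ℝ} (hab : a ≤ b) (hγU : ∀ s ∈ Icc a b, γ s ∈ U) {z₀ : ℂ} (hz₀ : z₀ ∈ U) :
    DifferentiableAt ℂ (fun z => ∫ s in a..b, dslope h z (γ s) * c s) z₀ := by
  obtain ⟨r, hr, hrU, B, hB⟩ := exists_norm_dslope_le hU hh
    ((isCompact_Icc (a := a) (b := b)).image hγ) (by rintro _ ⟨s, hs, rfl⟩; exact hγU s hs) hz₀
  obtain ⟨M, hM, hcM⟩ := exists_pos_norm_le_of_continuous hc a b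
  have hd : ∀ s ∈ Icc a b, DifferentiableOn ℂ (fun z => dslope h z (γ s)) U := by
    intro s hs
    simp_rw [fun z => dslope_comm h z (γ s)]
    exact (Complex.differentiableOn_dslope (hU.mem_nhds (hγU s hs))).2 hh
  have hcont : ∀ z ∈ U, ContinuousOn (fun s => dslope h z (γ s) * c s) (Icc a b) := fun z hz =>
    (continuousOn_dslope_comp hU hh hγ hγU hz).mul hc.continuousOn
  have hmeas : ∀ z ∈ U, AEStronglyMeasurable (fun s => dslope h z (γ s) * c s)
      (volume.restrict (uIoc a b)) := fun z hz => by
    rw [uIoc_of_le hab]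
    exact ((hcont z hz).mono Ioc_subset_Icc_self).aestronglyMeasurable measurableSet_Ioc
  have hIcc : ∀ s ∈ uIoc a b, s ∈ Icc a b := fun s hs => by
    rw [uIoc_of_le hab] at hs; exact Ioc_subset_Icc_self hs
  have hda : ∀ s ∈ Icc a b, ∀ z ∈ U, HasDerivAt (fun z => dslope h z (γ s) * c s)
      (deriv (fun z => dslope h z (γ s)) z * c s) z := fun s hs z hz =>
    (((hd s hs).differentiableAt (hU.mem_nhds hz)).hasDerivAt).mul_const _
  refine (intervalIntegral.hasDerivAt_integral_of_dominated_loc_of_deriv_le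
    (F := fun z s => dslope h z (γ s) * c s)
    (F' := fun z s => deriv (fun z => dslope h z (γ s)) z * c s)
    (bound := fun _ => B / (r / 2) * M) (s := Metric.ball z₀ (r / 2))
    (Metric.ball_mem_nhds z₀ (by positivity)) ?_ ?_ ?_ ?_ ?_ ?_).2.differentiableAt
  · filter_upwards [hU.mem_nhds hz₀] with z hz using hmeas z hz
  · refine ContinuousOn.intervalIntegrable ?_
    rw [uIcc_of_le hab]
    exact hcont z₀ hz₀
  -- The derivative is measurable in `s` as a pointwise limit of difference quotients along this
  -- sequence.
  · have hseq : Tendsto (fun n : ℕ => z₀ + ((r / 2 * (1 / ((n : ℝ) + 1)) : ℝ) : ℂ)) atTop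
        (𝓝[≠] z₀) := by
      refine tendsto_nhdsWithin_iff.2 ⟨?_, Eventually.of_forall fun n => ?_⟩
      · have h1 : Tendsto (fun n : ℕ => r / 2 * (1 / ((n : ℝ) + 1))) atTop (𝓝 (r / 2 * 0)) :=
          tendsto_one_div_add_atTop_nhds_zero_nat.const_mul _
        have h2 := ((Complex.continuous_ofReal.tendsto _).comp h1).const_add z₀
        simpa using h2
      · have : r / 2 * (1 / ((n : ℝ) + 1)) ≠ 0 := by positivity
        have h3 : ((r / 2 * (1 / ((n : ℝ) + 1)) : ℝ) : ℂ) ≠ 0 := Complex.ofReal_ne_zero.2 this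
        simpa using h3
    have hmem : ∀ n : ℕ, z₀ + ((r / 2 * (1 / ((n : ℝ) + 1)) : ℝ) : ℂ) ∈ U := by
      intro n
      refine hrU ?_
      rw [Metric.mem_ball, dist_eq_norm, add_sub_cancel_left, Complex.norm_real,
        Real.norm_of_nonneg (by positivity)]
      have : 1 / ((n : ℝ) + 1) ≤ 1 := by
        rw [div_le_one (by positivity)]
        linarith [Nat.cast_nonneg (α := ℝ) n]
      nlinarith
    refine aestronglyMeasurable_of_tendsto_ae (u := atTop)
      (f := fun (n : ℕ) s => slope (fun z => dslope h z (γ s) * c s) z₀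
        (z₀ + ((r / 2 * (1 / ((n : ℝ) + 1)) : ℝ) : ℂ))) (fun n => ?_) ?_
    · simp_rw [slope_def_field]
      simp_rw [div_eq_mul_inv]
      exact ((hmeas _ (hmem n)).sub (hmeas _ hz₀)).mul_const _
    · refine (ae_restrict_iff' measurableSet_uIoc).2 (Eventually.of_forall fun s hs => ?_)
      exact (hasDerivAt_iff_tendsto_slope.1 (hda s (hIcc s hs) z₀ hz₀)).comp hseq
  · refine Eventually.of_forall fun s hs z hz => ?_
    have hs' := hIcc s hs
    have hcb : Metric.closedBall z (r / 2) ⊆ Metric.ball z₀ r := by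
      refine Metric.closedBall_subset_ball' ?_
      rw [Metric.mem_ball] at hz
      linarith
    rw [norm_mul]
    have h1 : ‖deriv (fun z => dslope h z (γ s)) z‖ ≤ B / (r / 2) := by
      refine Complex.norm_deriv_le_of_forall_mem_sphere_norm_le (by positivity) ?_ ?_
      · refine DifferentiableOn.diffContOnCl ?_
        rw [closure_ball _ (by positivity)]
        exact (hd s hs').mono (hcb.trans hrU)
      · intro w hw
        exact hB w (hcb (Metric.sphere_subset_closedBall hw)) _ (mem_image_of_mem _ hs')
    exact mul_le_mul h1 (hcM s hs') (norm_nonneg _) ((norm_nonneg _).trans h1)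
  · exact intervalIntegrable_const
  · exact Eventually.of_forall fun s hs z hz => hda s (hIcc s hs) z
      (hrU (Metric.ball_subset_ball (by linarith) hz))

/-- The homological form of Cauchy's theorem, after Dixon. -/
theorem IsSmoothClosedContour.integral_dslope_eq_zero {γ : ℝ → ℂ} (hγ : IsSmoothClosedContour 1 γ)
    {U : Set ℂ} (hU : IsOpen U) (hγU : range γ ⊆ U) (hW : ∀ z ∉ U, windingIntegral γ z = 0)
    {h : ℂ → ℂ} (hh : DifferentiableOn ℂ h U) {z : ℂ} (hz : z ∈ U) :
    ∫ s in (0 : ℝ)..1, dslope h z (γ s) * deriv γ s = 0 := by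
  classical
  have hγU' : ∀ s, γ s ∈ U := fun s => hγU ⟨s, rfl⟩
  have hhγ : Continuous fun s => h (γ s) :=
    continuous_iff_continuousAt.2 fun s => ContinuousAt.comp
      (hh.differentiableAt (hU.mem_nhds (hγU' s))).continuousAt hγ.continuous.continuousAt
  set c : ℝ → ℂ := fun s => h (γ s) * deriv γ s with hc_def
  have hc : Continuous c := hhγ.mul hγ.continuous_deriv
  -- Dixon's function: the two formulas differ by `h z` times the winding integral, so they agree
  -- wherever the latter vanishes. The glued function is entire and tends to 0 at infinity, hence is
  -- 0 by Liouville.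
  set E : ℂ → ℂ := fun z => if z ∈ U then ∫ s in (0 : ℝ)..1, dslope h z (γ s) * deriv γ s
    else ∫ s in (0 : ℝ)..1, c s / (γ s - z) with hE
  have hoff : ∀ w, w ∉ range γ → windingIntegral γ w = 0 →
      E w = ∫ s in (0 : ℝ)..1, c s / (γ s - w) := by
    intro w hwr hw0
    by_cases hwU : w ∈ U
    · have hne : ∀ s, γ s - w ≠ 0 := fun s => sub_ne_zero.2 fun e => hwr ⟨s, e⟩
      simp only [hE, if_pos hwU]
      have h1 : ∀ s, dslope h w (γ s) * deriv γ s
          = c s / (γ s - w) - h w * (deriv γ s / (γ s - w)) := by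
        intro s
        rw [dslope_of_ne _ (sub_ne_zero.1 (hne s)), slope_def_field]
        have := hne s
        simp only [hc_def]
        field_simp
      simp_rw [h1]
      have hcs : Continuous fun s => γ s - w := hγ.continuous.sub continuous_const
      rw [intervalIntegral.integral_sub, intervalIntegral.integral_const_mul]
      · have : ∫ s in (0 : ℝ)..1, deriv γ s / (γ s - w) = 0 := hw0
        rw [this, mul_zero, sub_zero]
      · exact (hc.div hcs hne).intervalIntegrable _ _
      · exact (continuous_const.mul (hγ.continuous_deriv.div hcs hne)).intervalIntegrable _ _
    · simp only [hE, if_neg hwU]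
  have hdiff : Differentiable ℂ E := by
    intro w
    by_cases hwU : w ∈ U
    · refine (differentiableAt_integral_dslope hU hh hγ.continuous_deriv hγ.continuous zero_le_one
        (fun s _ => hγU' s) hwU).congr_of_eventuallyEq ?_
      filter_upwards [hU.mem_nhds hwU] with y hy
      simp only [hE, if_pos hy]
    · have hwr : w ∈ (range γ)ᶜ := fun hr => hwU (hγU hr)
      refine (hasDerivAt_cauchyTypeIntegral hc hγ.continuous zero_le_one
        fun s _ e => hwr ⟨s, e⟩).differentiableAt.congr_of_eventuallyEq ?_
      have hopen := hγ.isClosed_range.isOpen_compl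
      -- A neighbourhood of a boundary point of `U` may meet `U`; the winding integral vanishes on
      -- the whole component, so the second formula holds there too.
      filter_upwards [hopen.connectedComponentIn.mem_nhds (mem_connectedComponentIn hwr)] with y hy
      refine hoff y (connectedComponentIn_subset _ _ hy) ?_
      rw [hγ.windingIntegral_eq_of_mem_connectedComponentIn hwr hy, hW w hwU]
  have hlim : Tendsto E (cocompact ℂ) (𝓝 0) := by
    refine (tendsto_cauchyTypeIntegral_cocompact hc hγ.continuous zero_le_one).congr' ?_
    filter_upwards [hγ.eventually_windingIntegral_eq_zero] with w hw
    exact (hoff w hw.1 hw.2).symm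
  have := hdiff.apply_eq_of_tendsto_cocompact z hlim
  simpa only [hE, if_pos hz] using this

/-! ### Local geometry of the contour and the truncated arc -/

/-- A strict derivative makes g s' - g s equal to s' - s up to a quarter of |s' - s|, for all pairs
at once. In the difference of the squared norms the real parts then give at least 9/16 of s'² - s²,
and the imaginary parts take away at most 1/16. -/
theorem exists_strictMonoOn_norm {g : ℝ → ℂ} (hg : HasStrictDerivAt g 1 0) (hg0 : g 0 = 0) :
    ∃ δ > 0, (∀ s, |s| ≤ δ → ‖g s - s‖ ≤ |s| / 4) ∧
      StrictMonoOn (fun s => ‖g s‖) (Icc 0 δ) := by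
  have h := hg.hasStrictFDerivAt.isLittleO.def (c := 1 / 4) (by norm_num)
  rw [Metric.eventually_nhds_iff] at h
  obtain ⟨ε, hε, h⟩ := h
  have hb : ∀ s s', |s| ≤ ε / 2 → |s'| ≤ ε / 2 →
      ‖g s - g s' - ((s - s' : ℝ) : ℂ)‖ ≤ 1 / 4 * |s - s'| := by
    intro s s' hs hs'
    have := h (y := (s, s')) (by
      rw [Prod.dist_eq]
      simp only [dist_zero_right, Real.norm_eq_abs]
      exact max_lt (by linarith) (by linarith))
    simpa using this
  have h0 : |(0 : ℝ)| ≤ ε / 2 := by simp; positivity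
  refine ⟨ε / 2, by positivity, fun s hs => ?_, ?_⟩
  · have := hb s 0 hs h0
    rw [hg0] at this
    simp only [sub_zero] at this
    linarith
  · intro s hs s' hs' hlt
    have hs1 : |s| ≤ ε / 2 := by rw [abs_of_nonneg hs.1]; exact hs.2
    have hs2 : |s'| ≤ ε / 2 := by rw [abs_of_nonneg hs'.1]; exact hs'.2
    have h1 := hb s' s hs2 hs1
    have h2 := hb s' 0 hs2 h0
    have h3 := hb s 0 hs1 h0
    rw [hg0] at h2 h3
    simp only [sub_zero] at h2 h3
    have hs0 := hs.1
    have hs'0 := hs'.1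
    rw [abs_of_pos (by linarith : (0 : ℝ) < s' - s)] at h1
    rw [abs_of_nonneg hs'0] at h2
    rw [abs_of_nonneg hs0] at h3
    have r1 := (Complex.abs_re_le_norm _).trans h1
    have i1 := (Complex.abs_im_le_norm _).trans h1
    have r2 := (Complex.abs_re_le_norm _).trans h2
    have i2 := (Complex.abs_im_le_norm _).trans h2
    have r3 := (Complex.abs_re_le_norm _).trans h3
    have i3 := (Complex.abs_im_le_norm _).trans h3
    simp only [Complex.sub_re, Complex.sub_im, Complex.ofReal_re, Complex.ofReal_im,
      sub_zero] at r1 i1 r2 i2 r3 i3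
    rw [abs_le] at r1 i1 r2 i2 r3 i3
    have key : ‖g s‖ ^ 2 < ‖g s'‖ ^ 2 := by
      rw [← Complex.normSq_eq_norm_sq, ← Complex.normSq_eq_norm_sq, Complex.normSq_apply,
        Complex.normSq_apply]
      set A := (g s').re - (g s).re
      set B := (g s').im - (g s).im
      have hA : 3 / 4 * (s' - s) ≤ A := by linarith [r1.1]
      have hC : 3 / 4 * (s' + s) ≤ (g s').re + (g s).re := by linarith [r2.1, r3.1]
      have hD : |(g s').im + (g s).im| ≤ 1 / 4 * (s' + s) := by
        rw [abs_le]; constructor <;> linarith [i2.1, i2.2, i3.1, i3.2]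
      have hB : |B| ≤ 1 / 4 * (s' - s) := abs_le.2 i1
      have hpos : 0 < (s' - s) * (s' + s) := mul_pos (by linarith) (by linarith)
      have hAC : (3 / 4 * (s' - s)) * (3 / 4 * (s' + s)) ≤ A * ((g s').re + (g s).re) :=
        mul_le_mul hA hC (by linarith) (by linarith)
      have hBD : |B * ((g s').im + (g s).im)| ≤ (1 / 4 * (s' - s)) * (1 / 4 * (s' + s)) := by
        rw [abs_mul]
        exact mul_le_mul hB hD (abs_nonneg _) (by linarith)
      have := (abs_le.1 hBD).1
      simp only [A, B] at *
      nlinarith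
    exact lt_of_pow_lt_pow_left₀ 2 (norm_nonneg _) key

/-- The contour in the affine coordinate in which it passes through the origin with unit speed. -/
noncomputable def normalizedContour (γ : ℝ → ℂ) (s : ℝ) : ℂ := (γ s - γ 0) / deriv γ 0

namespace IsSmoothClosedContour

variable {γ : ℝ → ℂ}

theorem sub_eq_mul_normalizedContour (h : IsSmoothClosedContour 1 γ) (s : ℝ) :
    γ s - γ 0 = deriv γ 0 * normalizedContour γ s := by
  rw [normalizedContour, mul_div_cancel₀ _ (h.deriv_ne_zero 0)]

theorem hasDerivAt_normalizedContour (h : IsSmoothClosedContour 1 γ) (s : ℝ) :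
    HasDerivAt (normalizedContour γ) (deriv γ s / deriv γ 0) s :=
  ((h.hasDerivAt s).sub_const _).div_const _

theorem hasStrictDerivAt_normalizedContour (h : IsSmoothClosedContour 1 γ) :
    HasStrictDerivAt (normalizedContour γ) 1 0 := by
  have h1 := (h.contDiff.contDiffAt (x := 0)).hasStrictDerivAt (n := 1) (by norm_num)
  have h2 : HasStrictDerivAt (fun s => γ s - γ 0) (deriv γ 0) 0 := h1.sub_const (γ 0)
  have h3 := h2.const_mul (deriv γ 0)⁻¹
  rw [inv_mul_cancel₀ (h.deriv_ne_zero 0)] at h3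
  exact h3.congr_of_eventuallyEq
    (Eventually.of_forall fun s => by simp only [normalizedContour]; ring)

theorem apply_ne_of_mem_Ioo (h : IsSmoothClosedContour 1 γ) {s : ℝ} (hs : s ∈ Ioo (0 : ℝ) 1) :
    γ s ≠ γ 0 := fun e =>
  hs.1.ne' (h.injOn ⟨hs.1.le, hs.2⟩ ⟨le_rfl, one_pos⟩ e)

theorem exists_local_param (h : IsSmoothClosedContour 1 γ) :
    ∃ δ ∈ Ioo (0 : ℝ) (1 / 2),
      (∀ s, |s| ≤ δ → ‖normalizedContour γ s - s‖ ≤ |s| / 4) ∧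
      StrictMonoOn (fun s => ‖γ s - γ 0‖) (Icc 0 δ) ∧
      StrictMonoOn (fun s => ‖γ (-s) - γ 0‖) (Icc 0 δ) := by
  have hg := h.hasStrictDerivAt_normalizedContour
  have hg0 : normalizedContour γ 0 = 0 := by simp [normalizedContour]
  -- Reflection turns the branch s < 0 into a curve of the same kind.
  have hg' : HasStrictDerivAt (fun s => -normalizedContour γ (-s)) 1 0 := by
    have h1 : HasStrictDerivAt (fun s : ℝ => -s) (-1) 0 := (hasStrictDerivAt_id 0).neg
    have h2 : HasStrictDerivAt (normalizedContour γ) 1 (-0) := by rwa [neg_zero]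
    exact ((h2.scomp (0 : ℝ) h1).neg).congr_deriv (by simp)
  obtain ⟨δ₁, hδ₁, hb, hm₁⟩ := exists_strictMonoOn_norm hg hg0
  obtain ⟨δ₂, hδ₂, -, hm₂⟩ := exists_strictMonoOn_norm hg' (by simp [hg0])
  have hT : 0 < ‖deriv γ 0‖ := norm_pos_iff.2 (h.deriv_ne_zero 0)
  refine ⟨min (min δ₁ δ₂) (1 / 4), ⟨by positivity, ?_⟩, fun s hs => hb s (hs.trans ?_), ?_, ?_⟩
  · exact (min_le_right _ _).trans_lt (by norm_num)
  · exact (min_le_left _ _).trans (min_le_left _ _)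
  · intro s hs s' hs' hlt
    have hle : min (min δ₁ δ₂) (1 / 4) ≤ δ₁ := (min_le_left _ _).trans (min_le_left _ _)
    simp only [h.sub_eq_mul_normalizedContour, norm_mul]
    exact mul_lt_mul_of_pos_left (hm₁ ⟨hs.1, hs.2.trans hle⟩ ⟨hs'.1, hs'.2.trans hle⟩ hlt) hT
  · intro s hs s' hs' hlt
    have hle : min (min δ₁ δ₂) (1 / 4) ≤ δ₂ := (min_le_left _ _).trans (min_le_right _ _)
    simp only [h.sub_eq_mul_normalizedContour, norm_mul]
    have := hm₂ ⟨hs.1, hs.2.trans hle⟩ ⟨hs'.1, hs'.2.trans hle⟩ hlt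
    simp only [norm_neg] at this
    exact mul_lt_mul_of_pos_left this hT

end IsSmoothClosedContour

/-- Supplies the parameter at which a branch crosses the circle of radius v: it exists by the
intermediate value theorem and tends to 0 by monotonicity. -/
theorem StrictMonoOn.exists_rightInverse_tendsto {ρ : ℝ → ℝ} {δ : ℝ} (hδ : 0 < δ)
    (hc : ContinuousOn ρ (Icc 0 δ)) (hm : StrictMonoOn ρ (Icc 0 δ)) (h0 : ρ 0 = 0) :
    ∃ a : ℝ → ℝ, Tendsto a (𝓝[>] 0) (𝓝[>] 0) ∧
      ∀ᶠ v in 𝓝[>] (0 : ℝ), a v ∈ Ioo 0 δ ∧ ρ (a v) = v := by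
  have hex : ∀ v ∈ Ioo 0 (ρ δ), ∃ s, s ∈ Ioo 0 δ ∧ ρ s = v := by
    intro v hv
    obtain ⟨s, hs, rfl⟩ := intermediate_value_Ioo hδ.le hc (by rwa [h0] : v ∈ Ioo (ρ 0) (ρ δ))
    exact ⟨s, hs, rfl⟩
  choose! a ha using hex
  have h0m : (0 : ℝ) ∈ Icc 0 δ := ⟨le_rfl, hδ.le⟩
  have hpos : ∀ s ∈ Ioc 0 δ, 0 < ρ s := fun s hs => by
    rw [← h0]; exact hm h0m ⟨hs.1.le, hs.2⟩ hs.1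
  have hev : ∀ᶠ v in 𝓝[>] (0 : ℝ), v ∈ Ioo 0 (ρ δ) :=
    Ioo_mem_nhdsGT (hpos δ ⟨hδ, le_rfl⟩)
  refine ⟨a, tendsto_nhdsWithin_iff.2 ⟨?_, hev.mono fun v hv => (ha v hv).1.1⟩,
    hev.mono fun v hv => ha v hv⟩
  rw [Metric.tendsto_nhds]
  intro ε hε
  have hε' : min ε δ ∈ Ioc 0 δ := ⟨lt_min hε hδ, min_le_right _ _⟩
  filter_upwards [hev, Ioo_mem_nhdsGT (hpos _ hε')] with v hv hv'
  obtain ⟨h1, h2⟩ := ha v hv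
  rw [Real.dist_eq, sub_zero, abs_of_pos h1.1]
  have := (hm.lt_iff_lt ⟨h1.1.le, h1.2.le⟩ ⟨hε'.1.le, hε'.2⟩).1 (h2.trans_lt hv'.2)
  exact this.trans_le (min_le_left _ _)

/-- For small `v` the part of the contour outside the disc of radius `v` about `γ 0` is an arc. -/
theorem IsSmoothClosedContour.exists_truncation_arc {γ : ℝ → ℂ} (h : IsSmoothClosedContour 1 γ) :
    ∃ a b : ℝ → ℝ, Tendsto a (𝓝[>] 0) (𝓝[>] 0) ∧ Tendsto b (𝓝[>] 0) (𝓝[<] 0) ∧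
      ∀ᶠ v in 𝓝[>] (0 : ℝ), ‖γ (a v) - γ 0‖ = v ∧ ‖γ (b v) - γ 0‖ = v ∧ a v < 1 + b v ∧
        {s : ℝ | s ∈ Ioc (0 : ℝ) 1 ∧ v < ‖γ s - γ 0‖} = Ioo (a v) (1 + b v) := by
  obtain ⟨δ, ⟨hδ, hδ2⟩, -, hm₁, hm₂⟩ := h.exists_local_param
  have hc := h.continuous
  obtain ⟨a, hat, ha⟩ := hm₁.exists_rightInverse_tendsto hδ (by fun_prop) (by simp)
  obtain ⟨b, hbt, hb⟩ := hm₂.exists_rightInverse_tendsto hδ (by fun_prop) (by simp)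
  -- The middle arc stays at distance r from `γ 0`, so for v < r only the two end branches enter the
  -- disc.
  obtain ⟨r, hr, hrs⟩ := exists_pos_le_norm_sub hc (a := δ) (b := 1 - δ) (z := γ 0)
    fun s hs => h.apply_ne_of_mem_Ioo ⟨hδ.trans_le hs.1, by linarith [hs.2]⟩
  refine ⟨a, fun v => -b v, hat, ?_, ?_⟩
  · have := tendsto_neg_nhdsGT.comp hbt
    rwa [neg_zero] at this
  filter_upwards [ha, hb, Ioo_mem_nhdsGT hr] with v ⟨ha1, ha2⟩ ⟨hb1, hb2⟩ hv
  refine ⟨ha2, hb2, by linarith [ha1.2, hb1.2], ?_⟩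
  have hper : ∀ s, γ s = γ (-(1 - s)) := fun s => by
    rw [neg_sub, h.periodic.sub_eq]
  ext s
  simp only [mem_ofPred_eq, mem_Ioc, mem_Ioo]
  have hleft : s ∈ Icc 0 δ → (v < ‖γ s - γ 0‖ ↔ a v < s) := fun hs => by
    rw [← hm₁.lt_iff_lt ⟨ha1.1.le, ha1.2.le⟩ hs, ha2]
  have hright : s ∈ Icc (1 - δ) 1 → (v < ‖γ s - γ 0‖ ↔ b v < 1 - s) := fun hs => by
    rw [← hm₂.lt_iff_lt ⟨hb1.1.le, hb1.2.le⟩ ⟨by linarith [hs.2], by linarith [hs.1]⟩, hb2, ← hper]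
  have ha11 := ha1.1
  have ha12 := ha1.2
  have hb11 := hb1.1
  have hb12 := hb1.2
  constructor
  · rintro ⟨⟨h1, h2⟩, h3⟩
    rcases le_total s δ with h4 | h4
    · exact ⟨(hleft ⟨h1.le, h4⟩).1 h3, by linarith⟩
    · refine ⟨by linarith, ?_⟩
      rcases le_total s (1 - δ) with h5 | h5
      · linarith
      · linarith [(hright ⟨h5, h2⟩).1 h3]
  · rintro ⟨h1, h2⟩
    refine ⟨⟨by linarith, by linarith⟩, ?_⟩
    rcases le_total s δ with h4 | h4
    · exact (hleft ⟨by linarith, h4⟩).2 h1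
    · rcases le_total s (1 - δ) with h5 | h5
      · exact hv.2.trans_le (hrs s ⟨h4, h5⟩)
      · exact (hright ⟨h5, by linarith⟩).2 (by linarith)

/-! ### The principal value of the Cauchy kernel -/

theorem Complex.log_mul_of_re_pos {σ w : ℂ} (hw : 0 < w.re) (hσ0 : σ ≠ 0)
    (hσ : |σ.arg| ≤ Real.pi / 2) : log (σ * w) = log σ + log w := by
  have hw0 : w ≠ 0 := by rintro rfl; simp at hw
  have hargw := abs_lt.1 (abs_arg_lt_pi_div_two_iff.2 (Or.inl hw))
  have hθ := abs_le.1 hσ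
  exact log_mul hσ0 hw0 ⟨by linarith [hargw.1, hθ.1], by linarith [hargw.2, hθ.2]⟩

namespace IsSmoothClosedContour

variable {γ : ℝ → ℂ}

theorem normalizedContour_re_pos {s : ℝ}
    (hb : ‖normalizedContour γ s - s‖ ≤ |s| / 4) (hs : s ≠ 0) :
    0 < s * (normalizedContour γ s).re := by
  have h1 := (Complex.abs_re_le_norm _).trans hb
  rw [Complex.sub_re, Complex.ofReal_re] at h1
  have h2 : |s * ((normalizedContour γ s).re - s)| ≤ s ^ 2 / 4 := by
    rw [abs_mul, ← sq_abs]
    nlinarith [abs_nonneg s]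
  have h3 := (abs_le.1 h2).1
  have : 0 < s ^ 2 := by positivity
  nlinarith

/-- With the pole moved by -(ε/σ)γ'(0), the denominator is a constant multiple of ε + σg, g being
the normalized contour, so a logarithm is a primitive. The cases σ = ±i, ε > 0 serve poles off the
contour; σ = ±1, ε = 0 serve the truncated arcs. -/
theorem integral_log_right (h : IsSmoothClosedContour 1 γ) {a b : ℝ} (σ ε : ℂ)
    (hs : ∀ s ∈ uIcc a b, ε + σ * normalizedContour γ s ∈ Complex.slitPlane) (hσ : σ ≠ 0) :
    ∫ s in a..b, deriv γ s / (γ s - (γ 0 - ε / σ * deriv γ 0)) =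
      Complex.log (ε + σ * normalizedContour γ b) - Complex.log (ε + σ * normalizedContour γ a) := by
  have hT := h.deriv_ne_zero 0
  have heq : ∀ s, γ s - (γ 0 - ε / σ * deriv γ 0)
      = deriv γ 0 / σ * (ε + σ * normalizedContour γ s) := by
    intro s
    have := h.sub_eq_mul_normalizedContour s
    field_simp
    linear_combination σ * this
  have hne : ∀ s ∈ uIcc a b, γ s - (γ 0 - ε / σ * deriv γ 0) ≠ 0 := by
    intro s hs'
    rw [heq]
    exact mul_ne_zero (div_ne_zero hT hσ) (Complex.slitPlane_ne_zero (hs s hs'))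
  refine intervalIntegral.integral_eq_sub_of_hasDerivAt
    (f := fun s => Complex.log (ε + σ * normalizedContour γ s)) (fun s hs' => ?_) ?_
  · refine ((((h.hasDerivAt_normalizedContour s).const_mul σ).const_add ε).clog_real
      (hs s hs')).congr_deriv ?_
    rw [heq]
    have := Complex.slitPlane_ne_zero (hs s hs')
    field_simp
  · exact (h.continuous_deriv.continuousOn.div
      (h.continuous.sub continuous_const).continuousOn hne :
      ContinuousOn (fun s => deriv γ s / (γ s - (γ 0 - ε / σ * deriv γ 0))) _).intervalIntegrable

theorem periodic_deriv (h : IsSmoothClosedContour 1 γ) : Function.Periodic (deriv γ) 1 := by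
  intro s
  rw [← deriv_comp_add_const, h.periodic.funext]

/-- Away from s = 0 the factor ±i turns a nonzero real part into a nonzero imaginary part, so the
cut is avoided. -/
theorem slitPlane_of_re_pos {s : ℝ}
    (hb : ‖normalizedContour γ s - s‖ ≤ |s| / 4) {ε : ℝ} (hε : 0 ≤ ε) (hs : ε = 0 → s ≠ 0)
    {σ : ℂ} (hσ : σ = Complex.I ∨ σ = -Complex.I) :
    ε + σ * normalizedContour γ s ∈ Complex.slitPlane := by
  rcases eq_or_ne s 0 with rfl | hs0
  · have h0 : normalizedContour γ 0 = 0 := by simp [normalizedContour]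
    rw [h0, mul_zero, add_zero, Complex.ofReal_mem_slitPlane]
    exact lt_of_le_of_ne hε fun e => hs e.symm rfl
  · have := (pos_and_pos_or_neg_and_neg_of_mul_pos (normalizedContour_re_pos hb hs0))
    have hre : (normalizedContour γ s).re ≠ 0 := by
      rcases this with h | h
      · exact h.2.ne'
      · exact h.2.ne
    refine Or.inr ?_
    rcases hσ with rfl | rfl <;> simpa using hre

/-- The pole approaches `γ 0` along the normal, from the left for σ = i and from the right for σ =
-i. The far arc converges by continuity, and the near arc gives logarithms that remain continuous at
ε = 0. -/
theorem tendsto_windingIntegral (h : IsSmoothClosedContour 1 γ) {δ : ℝ} (hδ : δ ∈ Ioo (0 : ℝ) (1 / 2))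
    (hb : ∀ s, |s| ≤ δ → ‖normalizedContour γ s - s‖ ≤ |s| / 4)
    {σ : ℂ} (hσ : σ = Complex.I ∨ σ = -Complex.I) :
    (∀ᶠ ε : ℝ in 𝓝[>] 0, γ 0 - ε / σ * deriv γ 0 ∉ range γ) ∧
    Tendsto (fun ε : ℝ => windingIntegral γ (γ 0 - ε / σ * deriv γ 0)) (𝓝[>] 0)
      (𝓝 ((∫ s in δ..(1 - δ), deriv γ s / (γ s - γ 0)) +
        (Complex.log (σ * normalizedContour γ δ) - Complex.log (σ * normalizedContour γ (-δ))))) := by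
  obtain ⟨hδ0, hδ2⟩ := hδ
  have hσ0 : σ ≠ 0 := by rcases hσ with rfl | rfl <;> simp
  have hfar : ∀ s ∈ Icc δ (1 - δ), γ s ≠ γ 0 := fun s hs =>
    h.apply_ne_of_mem_Ioo ⟨by linarith [hs.1], by linarith [hs.2]⟩
  have hslit : ∀ ε : ℝ, 0 < ε → ∀ s ∈ uIcc (-δ) δ,
      ε + σ * normalizedContour γ s ∈ Complex.slitPlane := by
    intro ε hε s hs
    rw [uIcc_of_le (by linarith)] at hs
    exact slitPlane_of_re_pos (hb s (abs_le.2 hs)) hε.le (fun e => absurd e hε.ne') hσ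
  have hzt : Tendsto (fun ε : ℝ => γ 0 - ε / σ * deriv γ 0) (𝓝[>] 0) (𝓝 (γ 0)) := by
    have : Continuous fun ε : ℝ => γ 0 - ε / σ * deriv γ 0 := by fun_prop
    have h1 := (this.tendsto 0).mono_left (nhdsWithin_le_nhds (s := Ioi 0))
    simpa using h1
  have hnot : ∀ᶠ ε : ℝ in 𝓝[>] 0, γ 0 - ε / σ * deriv γ 0 ∉ range γ := by
    obtain ⟨r, hr, hrs⟩ := exists_pos_le_norm_sub h.continuous hfar
    filter_upwards [hzt (Metric.ball_mem_nhds _ hr), self_mem_nhdsWithin] with ε hε hε0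
    rw [← h.periodic.image_Icc one_pos (-δ)]
    rintro ⟨s, hs, hse⟩
    rcases le_total s δ with h1 | h1
    · have h2 := Complex.slitPlane_ne_zero (hslit ε hε0 s (by
        rw [uIcc_of_le (by linarith)]; exact ⟨hs.1, h1⟩))
      have h3 := h.sub_eq_mul_normalizedContour s
      rw [hse] at h3
      have h4 : deriv γ 0 * (ε + σ * normalizedContour γ s) = 0 := by
        field_simp at h3
        linear_combination -h3
      exact (mul_ne_zero (h.deriv_ne_zero 0) h2) h4
    · have h2 := hrs s ⟨h1, by linarith [hs.2]⟩
      rw [hse] at h2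
      rw [mem_preimage, Metric.mem_ball, dist_eq_norm] at hε
      linarith
  refine ⟨hnot, ?_⟩
  have h1 : Tendsto (fun ε : ℝ => ∫ s in δ..(1 - δ), deriv γ s / (γ s - (γ 0 - ε / σ * deriv γ 0)))
      (𝓝[>] 0) (𝓝 (∫ s in δ..(1 - δ), deriv γ s / (γ s - γ 0))) :=
    (hasDerivAt_cauchyTypeIntegral h.continuous_deriv h.continuous (by linarith)
      hfar).continuousAt.tendsto.comp hzt
  have hlog : ∀ s, |s| ≤ δ → s ≠ 0 →
      Tendsto (fun ε : ℝ => Complex.log (ε + σ * normalizedContour γ s)) (𝓝[>] 0)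
        (𝓝 (Complex.log (σ * normalizedContour γ s))) := by
    intro s hs hs0
    have h2 : Continuous fun ε : ℝ => (ε : ℂ) + σ * normalizedContour γ s := by fun_prop
    have h3 := (h2.tendsto 0).mono_left (nhdsWithin_le_nhds (s := Ioi 0))
    have h4 := slitPlane_of_re_pos (hb s hs) le_rfl (fun _ => hs0) hσ
    have h5 := h3.clog h4
    simpa using h5
  have h2 := h1.add ((hlog δ (abs_of_pos hδ0).le hδ0.ne').sub
    (hlog (-δ) (by rw [abs_neg, abs_of_pos hδ0]) (neg_ne_zero.2 hδ0.ne')))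
  refine h2.congr' ?_
  filter_upwards [hnot, self_mem_nhdsWithin] with ε hε hε0
  have hcont : Continuous fun s => deriv γ s / (γ s - (γ 0 - ε / σ * deriv γ 0)) :=
    h.continuous_deriv.div (h.continuous.sub continuous_const)
      fun s => sub_ne_zero.2 fun e => hε ⟨s, e⟩
  have hper : Function.Periodic (fun s => deriv γ s / (γ s - (γ 0 - ε / σ * deriv γ 0))) 1 :=
    fun s => by simp only [h.periodic s, h.periodic_deriv s]
  have h3 := hper.intervalIntegral_add_eq 0 (-δ)
  rw [zero_add] at h3
  rw [windingIntegral, h3, ← intervalIntegral.integral_add_adjacent_intervals (a := -δ) (b := δ)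
    (hcont.intervalIntegrable _ _) (hcont.intervalIntegrable _ _),
    h.integral_log_right σ ε (hslit ε hε0) hσ0, add_comm, neg_add_eq_sub]

/-- At the two cut points the logarithms have equal real parts, because the distances agree, and
their arguments tend to 0, because the chords turn to the tangent. -/
theorem tendsto_truncated_principalValue (h : IsSmoothClosedContour 1 γ) {δ : ℝ}
    (hδ : δ ∈ Ioo (0 : ℝ) (1 / 2))
    (hb : ∀ s, |s| ≤ δ → ‖normalizedContour γ s - s‖ ≤ |s| / 4) {a b : ℝ → ℝ}
    (ha : Tendsto a (𝓝[>] 0) (𝓝[>] 0)) (hbt : Tendsto b (𝓝[>] 0) (𝓝[<] 0))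
    (hab : ∀ᶠ v in 𝓝[>] (0 : ℝ), ‖γ (a v) - γ 0‖ = ‖γ (b v) - γ 0‖) :
    Tendsto (fun v => ∫ s in a v..1 + b v, deriv γ s / (γ s - γ 0)) (𝓝[>] 0)
      (𝓝 ((∫ s in δ..(1 - δ), deriv γ s / (γ s - γ 0)) +
        (Complex.log (normalizedContour γ δ) - Complex.log (-normalizedContour γ (-δ))))) := by
  obtain ⟨hδ0, hδ2⟩ := hδ
  have hder : Tendsto (fun s : ℝ => normalizedContour γ s / s) (𝓝[≠] 0) (𝓝 1) := by
    have := hasDerivAt_iff_tendsto_slope.1 h.hasStrictDerivAt_normalizedContour.hasDerivAt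
    refine this.congr fun s => ?_
    have h0 : normalizedContour γ 0 = 0 := by simp [normalizedContour]
    rw [slope_def_module, h0, sub_zero, sub_zero, Complex.real_smul, Complex.ofReal_inv,
      div_eq_inv_mul]
  have harg : ∀ {c : ℝ → ℝ}, Tendsto c (𝓝[>] 0) (𝓝[≠] 0) →
      Tendsto (fun v => (normalizedContour γ (c v) / c v).arg) (𝓝[>] 0) (𝓝 0) := by
    intro c hc
    have h1 := (Complex.continuousAt_arg (x := 1) (by simp)).tendsto.comp (hder.comp hc)
    simpa [Function.comp_def] using h1
  have ha' := harg (ha.mono_right (nhdsWithin_mono _ fun x hx => (ne_of_gt hx)))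
  have hb' := harg (hbt.mono_right (nhdsWithin_mono _ fun x hx => (ne_of_lt hx)))
  have hend : Tendsto (fun v => Complex.log (-normalizedContour γ (b v)) -
      Complex.log (normalizedContour γ (a v))) (𝓝[>] 0) (𝓝 0) := by
    have h1 := ((Complex.continuous_ofReal.tendsto _).comp (hb'.sub ha')).mul_const Complex.I
    rw [sub_zero, Complex.ofReal_zero, zero_mul] at h1
    refine h1.congr' ?_
    filter_upwards [hab, ha self_mem_nhdsWithin, hbt self_mem_nhdsWithin] with v hv hav hbv
    have hav' : 0 < a v := hav
    have hbv' : b v < 0 := hbv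
    have e1 : normalizedContour γ (a v) = (a v : ℂ) * (normalizedContour γ (a v) / a v) := by
      rw [mul_div_cancel₀]; exact_mod_cast hav'.ne'
    have e2 : -normalizedContour γ (b v) = ((-b v : ℝ) : ℂ) * (normalizedContour γ (b v) / b v) := by
      have : (b v : ℂ) ≠ 0 := by exact_mod_cast hbv'.ne
      push_cast
      field_simp
    have e3 : ‖normalizedContour γ (a v)‖ = ‖-normalizedContour γ (b v)‖ := by
      rw [norm_neg, normalizedContour, normalizedContour, norm_div, norm_div, hv]
    have e4 : (normalizedContour γ (a v)).arg = (normalizedContour γ (a v) / a v).arg := by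
      conv_lhs => rw [e1]
      exact Complex.arg_real_mul _ hav'
    have e5 : (-normalizedContour γ (b v)).arg = (normalizedContour γ (b v) / b v).arg := by
      rw [e2]
      exact Complex.arg_real_mul _ (neg_pos.2 hbv')
    rw [Complex.log, Complex.log, e3, e4, e5]
    simp only [Function.comp_apply]
    push_cast
    ring
  have hlim := (tendsto_const_nhds (x := (∫ s in δ..(1 - δ), deriv γ s / (γ s - γ 0)) +
        (Complex.log (normalizedContour γ δ) - Complex.log (-normalizedContour γ (-δ))))).add hend
  rw [add_zero] at hlim
  refine hlim.congr' ?_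
  filter_upwards [ha (Ioo_mem_nhdsGT hδ0), hbt (Ioo_mem_nhdsLT (neg_lt_zero.2 hδ0))] with v hav hbv
  rw [mem_preimage] at hav hbv
  have hint : ∀ c d, c ∈ Ioo (0 : ℝ) 1 → d ∈ Ioo (0 : ℝ) 1 →
      IntervalIntegrable (fun s => deriv γ s / (γ s - γ 0)) volume c d := by
    intro c d hc hd
    refine ContinuousOn.intervalIntegrable (h.continuous_deriv.continuousOn.div
      (h.continuous.sub continuous_const).continuousOn fun s hs => sub_ne_zero.2 ?_)
    exact h.apply_ne_of_mem_Ioo (ordConnected_Ioo.uIcc_subset hc hd hs)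
  have hI1 := h.integral_log_right (a := a v) (b := δ) 1 0 (fun s hs => by
    rw [uIcc_of_le hav.2.le] at hs
    have hs0 : 0 < s := hav.1.trans_le hs.1
    have := normalizedContour_re_pos (hb s (by rw [abs_of_pos hs0]; exact hs.2)) hs0.ne'
    refine Or.inl ?_
    simpa using (pos_iff_pos_of_mul_pos this).1 hs0) one_ne_zero
  have hI2 := h.integral_log_right (a := -δ) (b := b v) (-1) 0 (fun s hs => by
    rw [uIcc_of_le hbv.1.le] at hs
    have hs0 : s < 0 := hs.2.trans_lt hbv.2
    have := normalizedContour_re_pos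
      (hb s (by rw [abs_of_neg hs0]; linarith [hs.1])) hs0.ne
    refine Or.inl ?_
    simpa using (neg_iff_neg_of_mul_pos this).1 hs0) (neg_ne_zero.2 one_ne_zero)
  have hshift : ∫ s in (1 - δ)..(1 + b v), deriv γ s / (γ s - γ 0)
      = ∫ s in (-δ)..(b v), deriv γ s / (γ s - γ 0) := by
    have := intervalIntegral.integral_comp_add_right (a := -δ) (b := b v)
      (fun s => deriv γ s / (γ s - γ 0)) 1
    simp only [h.periodic _, h.periodic_deriv _] at this
    rw [this, neg_add_eq_sub, add_comm (b v)]
  simp only [zero_div, zero_mul, sub_zero, zero_add, one_mul, neg_mul] at hI1 hI2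
  have m1 : a v ∈ Ioo (0 : ℝ) 1 := ⟨hav.1, by linarith [hav.2]⟩
  have m2 : δ ∈ Ioo (0 : ℝ) 1 := ⟨hδ0, by linarith⟩
  have m3 : 1 - δ ∈ Ioo (0 : ℝ) 1 := ⟨by linarith, by linarith⟩
  have m4 : 1 + b v ∈ Ioo (0 : ℝ) 1 := ⟨by linarith [hbv.1], by linarith [hbv.2]⟩
  rw [← intervalIntegral.integral_add_adjacent_intervals (hint _ _ m1 m2) (hint _ _ m2 m4),
    ← intervalIntegral.integral_add_adjacent_intervals (hint _ _ m2 m3) (hint _ _ m3 m4),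
    hshift, hI1, hI2]
  ring

/-- The principal value of the Cauchy kernel at a point of a positively oriented contour. -/
theorem tendsto_truncated_inv (h : IsSmoothClosedContour 1 γ) (ho : IsPositivelyOriented γ)
    {a b : ℝ → ℝ}
    (ha : Tendsto a (𝓝[>] 0) (𝓝[>] 0)) (hbt : Tendsto b (𝓝[>] 0) (𝓝[<] 0))
    (hab : ∀ᶠ v in 𝓝[>] (0 : ℝ), ‖γ (a v) - γ 0‖ = ‖γ (b v) - γ 0‖) :
    Tendsto (fun v => ∫ s in a v..1 + b v, deriv γ s / (γ s - γ 0)) (𝓝[>] 0)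
      (𝓝 (Real.pi * Complex.I)) := by
  obtain ⟨δ, hδ, hb, -⟩ := h.exists_local_param
  have h1 := h.tendsto_truncated_principalValue hδ hb ha hbt hab
  obtain ⟨n2, h2⟩ := h.tendsto_windingIntegral hδ hb (Or.inl rfl)
  obtain ⟨n3, h3⟩ := h.tendsto_windingIntegral hδ hb (Or.inr rfl)
  -- The one-sided limits are the principal value plus and minus πi, and both lie in this closed
  -- pair. Hence they are 2πi and 0, and the other three cases are contradictory.
  have hclosed : IsClosed ({0, 2 * Real.pi * Complex.I} : Set ℂ) := (Set.toFinite _).isClosed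
  have m2 := hclosed.mem_of_tendsto h2 (n2.mono fun ε hε => h.windingIntegral_mem ho hε)
  have m3 := hclosed.mem_of_tendsto h3 (n3.mono fun ε hε => h.windingIntegral_mem ho hε)
  have hpos : 0 < (normalizedContour γ δ).re :=
    (pos_iff_pos_of_mul_pos (normalizedContour_re_pos (hb δ (abs_of_pos hδ.1).le) hδ.1.ne')).1 hδ.1
  have hneg : 0 < (-normalizedContour γ (-δ)).re := by
    have := normalizedContour_re_pos (hb (-δ) (by rw [abs_neg, abs_of_pos hδ.1]))
      (neg_ne_zero.2 hδ.1.ne')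
    have := (neg_iff_neg_of_mul_pos this).1 (neg_lt_zero.2 hδ.1)
    simpa using this
  have hI : |Complex.I.arg| ≤ Real.pi / 2 := by
    rw [Complex.arg_I, abs_of_pos (by positivity)]
  have hI' : |(-Complex.I).arg| ≤ Real.pi / 2 := by
    rw [Complex.arg_neg_I, abs_neg, abs_of_pos (by positivity)]
  have hI0 := neg_ne_zero.2 Complex.I_ne_zero
  have e1 : Complex.I * normalizedContour γ (-δ) = -Complex.I * -normalizedContour γ (-δ) := by ring
  have e2 : -Complex.I * normalizedContour γ (-δ) = Complex.I * -normalizedContour γ (-δ) := by ring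
  rw [e1, Complex.log_mul_of_re_pos hpos Complex.I_ne_zero hI,
    Complex.log_mul_of_re_pos hneg hI0 hI', Complex.log_I, Complex.log_neg_I] at m2
  rw [e2, Complex.log_mul_of_re_pos hneg Complex.I_ne_zero hI,
    Complex.log_mul_of_re_pos hpos hI0 hI', Complex.log_I, Complex.log_neg_I] at m3
  have hπ : (Real.pi : ℂ) * Complex.I ≠ 0 :=
    mul_ne_zero (Complex.ofReal_ne_zero.2 Real.pi_ne_zero) Complex.I_ne_zero
  convert h1 using 2
  rw [mem_insert_iff, mem_singleton_iff] at m2 m3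
  rcases m2 with m2 | m2 <;> rcases m3 with m3 | m3
  · exact absurd (by linear_combination (m2 - m3) / 2) hπ
  · exact absurd (by linear_combination (m2 - m3) / 4) hπ
  · linear_combination -m3
  · exact absurd (by linear_combination (m2 - m3) / 2) hπ

end IsSmoothClosedContour

/-! ### Expansions in the signed distance -/

theorem AnalyticAt.dslope_self {𝕜 E : Type*} [NontriviallyNormedField 𝕜] [NormedAddCommGroup E]
    [NormedSpace 𝕜 E] {f : 𝕜 → E} {z : 𝕜} (hf : AnalyticAt 𝕜 f z) :
    AnalyticAt 𝕜 (dslope f z) z := by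
  obtain ⟨q, hq⟩ := hf
  exact ⟨_, hq.has_fpower_series_dslope_fslope⟩


/-- An analytic function has polynomial expansions of every order in a regular coordinate. -/
theorem AnalyticAt.exists_polynomial_isLittleO {u : ℝ → ℂ} (hu : AnalyticAt ℝ u 0) (hu0 : u 0 = 0)
    (hu1 : deriv u 0 ≠ 0) (n : ℕ) {f : ℝ → ℂ} (hf : AnalyticAt ℝ f 0) :
    ∃ Q : Polynomial ℂ, Q.natDegree ≤ n ∧
      (fun s => f s - Q.eval (u s)) =o[𝓝 0] fun s : ℝ => s ^ n := by
  induction n generalizing f with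
  | zero =>
    refine ⟨Polynomial.C (f 0), by simp, ?_⟩
    simp only [Polynomial.eval_C, pow_zero]
    rw [isLittleO_one_iff]
    simpa using hf.continuousAt.tendsto.sub_const (f 0)
  | succ n ih =>
    have hdu : dslope u 0 0 ≠ 0 := by rwa [dslope_same]
    -- Induction through f = f(0) + u · (`dslope f 0` / `dslope u 0`), whose quotient is analytic
    -- again.
    obtain ⟨Q, hQ, hlo⟩ := ih (hf.dslope_self.div hu.dslope_self hdu)
    refine ⟨Polynomial.C (f 0) + Polynomial.X * Q, ?_, ?_⟩
    · refine (Polynomial.natDegree_add_le _ _).trans (max_le (by simp) ?_)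
      refine Polynomial.natDegree_mul_le.trans ?_
      rw [Polynomial.natDegree_X]
      omega
    · have huO : u =O[𝓝 0] fun s : ℝ => s := by
        have := hu.differentiableAt.isBigO_sub
        simpa [hu0] using this
      have h1 := huO.mul_isLittleO hlo
      refine (h1.congr' ?_ ?_)
      · filter_upwards [hu.dslope_self.continuousAt.eventually_ne hdu] with s hs
        have e1 := sub_smul_dslope f 0 s
        have e2 := sub_smul_dslope u 0 s
        rw [hu0] at e2
        simp only [sub_zero, Complex.real_smul] at e1 e2
        simp only [Pi.div_apply, Polynomial.eval_add, Polynomial.eval_C, Polynomial.eval_mul,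
          Polynomial.eval_X]
        have e3 : u s * (dslope f 0 s / dslope u 0 s) = f s - f 0 := by
          rw [← e2, ← e1]
          field_simp
        linear_combination e3
      · exact Eventually.of_forall fun s => (pow_succ' s n).symm

/-- A curve of class `C^(n+1)` through the origin is, to order `n + 1`, an analytic one. -/
theorem exists_analyticAt_isLittleO {g : ℝ → ℂ} {n : ℕ} (hg : ContDiff ℝ (n + 1 : ℕ) g)
    (hg0 : g 0 = 0) (hg1 : HasDerivAt g 1 0) :
    ∃ q : ℝ → ℂ, AnalyticAt ℝ q 0 ∧ q 0 = 1 ∧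
      (fun s : ℝ => g s / s - q s) =o[𝓝[≠] 0] fun s : ℝ => s ^ n := by
  have ht := taylor_isLittleO_univ (x₀ := 0) hg
  set P : ℝ → ℂ := fun s => taylorWithinEval g (n + 1) univ 0 s with hP
  have hPa : AnalyticAt ℝ P 0 := by
    have : P = fun s => ∑ k ∈ Finset.range (n + 1 + 1),
        ((k.factorial : ℝ)⁻¹ * (s - 0) ^ k) • iteratedDerivWithin k g univ 0 := by
      funext s
      exact taylor_within_apply _ _ _ _ _
    rw [this]
    fun_prop
  have hP0 : P 0 = 0 := by simp only [hP, taylorWithinEval_self, hg0]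
  simp only [sub_zero] at ht
  have hP1 : HasDerivAt P 1 0 := by
    have h1 : (fun s => g s - P s) =o[𝓝 0] fun s : ℝ => s := by
      have h0 : (fun s : ℝ => s ^ (n + 1)) =O[𝓝 0] fun s : ℝ => s := by
        have h := (isBigO_refl (fun s : ℝ => s) (𝓝 0)).mul
          (((continuous_pow n).continuousAt (x := (0 : ℝ))).isBigO_one (F := ℝ))
        simpa [pow_succ'] using h
      exact ht.trans_isBigO h0
    have h2 : HasDerivAt (fun s => g s - P s) 0 0 := by
      rw [hasDerivAt_iff_isLittleO]
      simpa [hg0, hP0] using h1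
    refine ((hg1.sub h2).congr_deriv (sub_zero 1)).congr_of_eventuallyEq
      (Eventually.of_forall fun s => ?_)
    simp
  refine ⟨dslope P 0, hPa.dslope_self, by rw [dslope_same, hP1.deriv], ?_⟩
  have h3 := (ht.mono nhdsWithin_le_nhds).mul_isBigO
    (isBigO_of_le (g := fun s : ℝ => s⁻¹) (f := fun s : ℝ => (s : ℂ)⁻¹) (𝓝[≠] 0)
      fun s => by simp)
  refine h3.congr' ?_ ?_
  · filter_upwards [self_mem_nhdsWithin] with s hs
    have hs0 : (s : ℂ) ≠ 0 := Complex.ofReal_ne_zero.2 hs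
    have e1 := sub_smul_dslope P 0 s
    rw [hP0, sub_zero, sub_zero, Complex.real_smul] at e1
    have e2 : P s = taylorWithinEval g (n + 1) univ 0 s := rfl
    rw [← e2, ← e1]
    field_simp
  · filter_upwards [self_mem_nhdsWithin] with s hs
    rw [pow_succ, mul_inv_cancel_right₀ hs]

theorem Complex.analyticAt_real_norm {z : ℂ} (hz : z ≠ 0) :
    AnalyticAt ℝ (fun w : ℂ => (‖w‖ : ℂ)) z :=
  (Complex.ofRealCLM.analyticAt _).comp (contDiffAt_norm ℝ hz).analyticAt

theorem HasStrictFDerivAt.isBigO_sub_of_tendsto {α 𝕜 E F : Type*} [NontriviallyNormedField 𝕜]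
    [NormedAddCommGroup E] [NormedSpace 𝕜 E] [NormedAddCommGroup F] [NormedSpace 𝕜 F]
    {f : E → F} {f' : E →L[𝕜] F} {x : E} (hf : HasStrictFDerivAt f f' x) {l : Filter α}
    {a b : α → E} (ha : Tendsto a l (𝓝 x)) (hb : Tendsto b l (𝓝 x)) :
    (fun i => f (a i) - f (b i)) =O[l] fun i => a i - b i :=
  hf.isBigO_sub.comp_tendsto (k := fun i => (a i, b i)) (ha.prodMk_nhds hb)

/-- Expansion of the negative powers of a regular curve in the signed distance to the origin. -/
theorem exists_polynomial_signedDist {g : ℝ → ℂ} {n : ℕ} (hg : ContDiff ℝ (n + 1 : ℕ) g)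
    (hg0 : g 0 = 0) (hg1 : HasDerivAt g 1 0) :
    ∃ Q : Polynomial ℂ, Q.natDegree ≤ n ∧
      (fun s : ℝ => (‖g s / s‖ / (g s / s) : ℂ) ^ n - Q.eval (s * ‖g s / s‖ : ℂ))
        =o[𝓝[≠] 0] fun s : ℝ => s ^ n := by
  -- The expansion is made for the analytic `q`, in the coordinate s‖q s‖. Strict differentiability
  -- then carries it back to g s / s with an error o(sⁿ).
  obtain ⟨q, hq, hq0, hgq⟩ := exists_analyticAt_isLittleO hg hg0 hg1
  have hnorm := Complex.analyticAt_real_norm (z := 1) one_ne_zero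
  have hqt : Tendsto q (𝓝[≠] 0) (𝓝 1) := by
    rw [← hq0]; exact hq.continuousAt.tendsto.mono_left nhdsWithin_le_nhds
  have hgt : Tendsto (fun s : ℝ => g s / s) (𝓝[≠] 0) (𝓝 1) := by
    refine (hasDerivAt_iff_tendsto_slope.1 hg1).congr fun s => ?_
    rw [slope_def_module, hg0, sub_zero, sub_zero, Complex.real_smul, Complex.ofReal_inv,
      div_eq_inv_mul]
  have he : AnalyticAt ℝ (fun w : ℂ => (‖w‖ / w : ℂ) ^ n) 1 :=
    (hnorm.div analyticAt_id one_ne_zero).pow n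
  rw [← hq0] at hnorm he
  have hid : AnalyticAt ℝ (fun s : ℝ => (s : ℂ)) 0 := Complex.ofRealCLM.analyticAt _
  have hnq : AnalyticAt ℝ (fun s => (‖q s‖ : ℂ)) 0 := hnorm.comp hq
  have hu : AnalyticAt ℝ (fun s : ℝ => (s * ‖q s‖ : ℂ)) 0 := hid.mul hnq
  have hu1 : deriv (fun s : ℝ => (s * ‖q s‖ : ℂ)) 0 ≠ 0 := by
    have h1 : HasDerivAt (fun s : ℝ => (s : ℂ)) 1 0 := Complex.ofRealCLM.hasDerivAt
    have h2 := (h1.mul hnq.differentiableAt.hasDerivAt).deriv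
    have h3 : (fun s : ℝ => (s : ℂ)) * (fun s => (‖q s‖ : ℂ)) = fun s : ℝ => (s * ‖q s‖ : ℂ) := rfl
    rw [h3] at h2
    rw [h2]
    simp [hq0]
  obtain ⟨Q, hQ, hlo⟩ := hu.exists_polynomial_isLittleO (by simp) hu1 n (he.comp hq)
  refine ⟨Q, hQ, ?_⟩
  rw [hq0] at hnorm he
  have h1 := (he.hasStrictFDerivAt.isBigO_sub_of_tendsto hgt hqt).trans_isLittleO hgq
  have h2 := (hnorm.hasStrictFDerivAt.isBigO_sub_of_tendsto hgt hqt).trans_isLittleO hgq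
  have hbdd : (fun s : ℝ => (s : ℂ)) =O[𝓝[≠] 0] fun _ : ℝ => (1 : ℝ) :=
    (hid.continuousAt.isBigO_one ℝ).mono nhdsWithin_le_nhds
  have h3 := hbdd.mul_isLittleO h2
  simp only [one_mul] at h3
  have hst : Tendsto (fun s : ℝ => (s : ℂ)) (𝓝[≠] 0) (𝓝 0) := by
    have := hid.continuousAt.tendsto.mono_left (nhdsWithin_le_nhds (s := {0}ᶜ))
    simpa using this
  have hnt : ∀ {y : ℝ → ℂ}, Tendsto y (𝓝[≠] 0) (𝓝 1) →
      Tendsto (fun s : ℝ => (s * ‖y s‖ : ℂ)) (𝓝[≠] 0) (𝓝 0) := fun hy => by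
    simpa using hst.mul (hnorm.continuousAt.tendsto.comp hy)
  have h4 : (fun s : ℝ => Q.eval (s * ‖g s / s‖ : ℂ) - Q.eval (s * ‖q s‖ : ℂ))
      =o[𝓝[≠] 0] fun s : ℝ => s ^ n := by
    refine ((Q.hasStrictDerivAt 0).hasStrictFDerivAt.isBigO_sub_of_tendsto (hnt hgt)
      (hnt hqt)).trans_isLittleO (h3.congr_left fun s => ?_)
    ring
  refine ((h1.add (hlo.mono nhdsWithin_le_nhds)).sub h4).congr_left fun s => ?_
  simp only [Function.comp_apply]
  ring

/-! ### Kernels of order at least two -/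

/-- The sign (-1)ⁿ makes the coefficients of Xⁿ in the two terms equal. After division by vⁿ this
coefficient would have been a finite part. -/
theorem Polynomial.degree_sub_comp_lt {Q : Polynomial ℂ} {n : ℕ} (hQ : Q.natDegree ≤ n) (r : ℂ) :
    (Q.comp (C r * X) - C ((-1) ^ n) * Q.comp (C (-r) * X)).degree < (n : WithBot ℕ) := by
  rw [Polynomial.degree_lt_iff_coeff_zero]
  intro m hm
  rw [coeff_sub, coeff_C_mul, comp_C_mul_X_coeff, comp_C_mul_X_coeff]
  rcases hm.eq_or_lt with rfl | hm
  · rw [neg_pow r, mul_left_comm (Q.coeff n), ← mul_assoc, ← mul_pow]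
    simp
  · rw [coeff_eq_zero_of_natDegree_lt (hQ.trans_lt hm)]
    simp

namespace IsSmoothClosedContour

variable {γ : ℝ → ℂ}

theorem contDiff_normalizedContour {n : ℕ} (h : IsSmoothClosedContour n γ) :
    ContDiff ℝ n (normalizedContour γ) :=
  (h.contDiff.sub contDiff_const).div_const _

theorem integral_inv_pow (h : IsSmoothClosedContour 1 γ) {n : ℕ} (hn : n ≠ 0) {a b : ℝ}
    (ha : 0 < a) (hb : b < 0) (hab : a < 1 + b) :
    ∫ s in a..1 + b, deriv γ s / (γ s - γ 0) ^ (n + 1) =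
      (n : ℂ)⁻¹ * (((γ a - γ 0) ^ n)⁻¹ - ((γ b - γ 0) ^ n)⁻¹) := by
  have hne : ∀ s ∈ uIcc a (1 + b), γ s - γ 0 ≠ 0 := fun s hs => by
    rw [uIcc_of_le hab.le] at hs
    exact sub_ne_zero.2 (h.apply_ne_of_mem_Ioo ⟨ha.trans_le hs.1, by linarith [hs.2]⟩)
  have hn' : (n : ℂ) ≠ 0 := Nat.cast_ne_zero.2 hn
  have hper : γ (1 + b) = γ b := by rw [add_comm]; exact h.periodic b
  rw [intervalIntegral.integral_eq_sub_of_hasDerivAt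
    (f := fun s => -((n : ℂ)⁻¹ * ((γ s - γ 0) ^ n)⁻¹))]
  · rw [hper]; ring
  · intro s hs
    have h1 := ((((h.hasDerivAt s).sub_const (γ 0)).fun_pow n).fun_inv
      (pow_ne_zero n (hne s hs))).const_mul (n : ℂ)⁻¹
    refine h1.neg.congr_deriv ?_
    have := hne s hs
    obtain ⟨m, rfl⟩ := Nat.exists_eq_succ_of_ne_zero hn
    simp only [Nat.succ_eq_add_one, Nat.add_sub_cancel]
    field_simp
    ring
  · exact (h.continuous_deriv.continuousOn.div ((h.continuous.sub continuous_const).pow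
      (n + 1)).continuousOn (fun s hs => pow_ne_zero _ (hne s hs)) :
      ContinuousOn (fun s => deriv γ s / (γ s - γ 0) ^ (n + 1)) _).intervalIntegrable

theorem isBigO_norm_sub (h : IsSmoothClosedContour 1 γ) :
    (fun s : ℝ => s) =O[𝓝[≠] 0] fun s => ‖γ s - γ 0‖ := by
  obtain ⟨δ, hδ, hb, -⟩ := h.exists_local_param
  have hT : 0 < ‖deriv γ 0‖ := norm_pos_iff.2 (h.deriv_ne_zero 0)
  refine IsBigO.of_bound (2 / ‖deriv γ 0‖) ?_
  have hev : ∀ᶠ s : ℝ in 𝓝[≠] 0, |s| < δ := by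
    have : Tendsto (fun s : ℝ => |s|) (𝓝[≠] 0) (𝓝 0) := by
      simpa using (continuous_abs.tendsto (0 : ℝ)).mono_left nhdsWithin_le_nhds
    exact this.eventually_lt_const hδ.1
  filter_upwards [hev] with s hs
  have h1 := hb s hs.le
  have h2 : ‖(s : ℂ)‖ ≤ ‖normalizedContour γ s‖ + ‖normalizedContour γ s - s‖ := by
    have := norm_sub_le (normalizedContour γ s) (normalizedContour γ s - s)
    rwa [sub_sub_cancel] at this
  rw [Complex.norm_real, Real.norm_eq_abs] at h2
  rw [norm_norm, h.sub_eq_mul_normalizedContour, norm_mul, Real.norm_eq_abs]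
  have e : 2 / ‖deriv γ 0‖ * (‖deriv γ 0‖ * ‖normalizedContour γ s‖)
      = 2 * ‖normalizedContour γ s‖ := by field_simp
  rw [e]
  linarith [abs_nonneg s]

/-- The kernels of order at least two have no finite part. -/
theorem exists_polynomial_tendsto_integral_inv_pow {n : ℕ} (hn : n ≠ 0)
    (h : IsSmoothClosedContour (n + 1) γ) {a b : ℝ → ℝ}
    (ha : Tendsto a (𝓝[>] 0) (𝓝[>] 0)) (hb : Tendsto b (𝓝[>] 0) (𝓝[<] 0))
    (hav : ∀ᶠ v in 𝓝[>] (0 : ℝ), ‖γ (a v) - γ 0‖ = v ∧ ‖γ (b v) - γ 0‖ = v ∧ a v < 1 + b v) :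
    ∃ ξ : Polynomial ℂ, ξ.degree < (n : WithBot ℕ) ∧
      Tendsto (fun v : ℝ => (∫ s in a v..1 + b v, deriv γ s / (γ s - γ 0) ^ (n + 1)) +
        ξ.eval (v : ℂ) / (v : ℂ) ^ n) (𝓝[>] 0) (𝓝 0) := by
  have h1 := h.mono (m := 1) (by omega)
  set T := deriv γ 0 with hT_def
  have hT : T ≠ 0 := h.deriv_ne_zero 0
  have hTn : (‖T‖ : ℂ) ≠ 0 := Complex.ofReal_ne_zero.2 (norm_ne_zero_iff.2 hT)
  obtain ⟨Q, hQ, hlo⟩ := exists_polynomial_signedDist h.contDiff_normalizedContour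
    (by simp [normalizedContour]) h1.hasStrictDerivAt_normalizedContour.hasDerivAt
  -- Both cut points at once: σ is the sign of the parameter c v, and σv is the signed distance.
  have key : ∀ {c : ℝ → ℝ} (σ : ℝ), σ ^ 2 = 1 → Tendsto c (𝓝[>] 0) (𝓝[≠] 0) →
      (∀ᶠ v in 𝓝[>] (0 : ℝ), ‖γ (c v) - γ 0‖ = v ∧ |c v| = σ * c v) →
      Tendsto (fun v : ℝ => ((γ (c v) - γ 0) ^ n)⁻¹ -
        (T ^ n)⁻¹ * (σ * ‖T‖ : ℂ) ^ n * Q.eval (σ * (v / ‖T‖) : ℂ) / (v : ℂ) ^ n) (𝓝[>] 0) (𝓝 0) := by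
    intro c σ hσ hc hcv
    have hσC : (σ : ℂ) ^ 2 = 1 := by exact_mod_cast hσ
    have hO : (fun v => c v) =O[𝓝[>] 0] fun v : ℝ => v :=
      (h1.isBigO_norm_sub.comp_tendsto hc).congr' (Eventually.of_forall fun _ => rfl)
        (hcv.mono fun v hv => hv.1)
    have h2 := (((hlo.comp_tendsto hc).trans_isBigO
      (hO.pow n)).tendsto_inv_smul_nhds_zero).const_mul ((T ^ n)⁻¹ * (σ * ‖T‖ : ℂ) ^ n)
    rw [mul_zero] at h2
    refine h2.congr' ?_
    filter_upwards [hcv, hc self_mem_nhdsWithin, self_mem_nhdsWithin] with v ⟨hv1, hv2⟩ hv3 hv4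
    have hc0 : (c v : ℂ) ≠ 0 := Complex.ofReal_ne_zero.2 hv3
    have hv0 : (v : ℂ) ≠ 0 := Complex.ofReal_ne_zero.2 (ne_of_gt hv4)
    have hσ0 : (σ : ℂ) ≠ 0 := fun e => by simp [e] at hσC
    have hTN := h1.sub_eq_mul_normalizedContour (c v)
    have hN : (‖normalizedContour γ (c v) / c v‖ : ℂ) = v / (‖T‖ * (σ * c v)) := by
      have : ‖normalizedContour γ (c v) / c v‖ = v / (‖T‖ * (σ * c v)) := by
        rw [normalizedContour, norm_div, norm_div, hv1, Complex.norm_real, Real.norm_eq_abs, hv2,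
          div_div]
      rw [this]
      push_cast
      rfl
    have hN0 : normalizedContour γ (c v) ≠ 0 := by
      intro e
      rw [hTN, e, mul_zero, norm_zero] at hv1
      exact (ne_of_gt hv4) hv1.symm
    have e1 : (c v : ℂ) * (v / (‖T‖ * (σ * c v))) = σ * (v / ‖T‖) := by
      field_simp
      exact hσC.symm
    have e2 : (v / (‖T‖ * (σ * c v)) / (normalizedContour γ (c v) / c v) : ℂ)
        = σ * (v / (‖T‖ * normalizedContour γ (c v))) := by
      field_simp
      exact hσC.symm
    simp only [Function.comp_apply]
    rw [hN, e1, e2, hTN, Complex.real_smul, Complex.ofReal_inv, Complex.ofReal_pow, ← hT_def]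
    have hσn : ((σ : ℂ) ^ n) ^ 2 = 1 := by rw [← pow_mul, mul_comm n, pow_mul, hσC, one_pow]
    have hσn0 := pow_ne_zero n hσ0
    have hcancel : (T ^ n)⁻¹ * (σ * ‖T‖ : ℂ) ^ n * (((v : ℂ) ^ n)⁻¹ *
        (σ * (v / (‖T‖ * normalizedContour γ (c v)))) ^ n) =
        ((T * normalizedContour γ (c v)) ^ n)⁻¹ := by
      simp only [mul_pow, div_pow]
      field_simp
      exact hσn
    rw [← hcancel]
    ring
  have ka := key (c := a) 1 (by norm_num) (ha.mono_right (nhdsWithin_mono _ fun x hx => ne_of_gt hx))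
    (by
      filter_upwards [hav, ha self_mem_nhdsWithin] with v hv hv'
      exact ⟨hv.1, by rw [one_mul, abs_of_pos hv']⟩)
  have kb := key (c := b) (-1) (by norm_num)
    (hb.mono_right (nhdsWithin_mono _ fun x hx => ne_of_lt hx)) (by
      filter_upwards [hav, hb self_mem_nhdsWithin] with v hv hv'
      exact ⟨hv.2.1, by rw [neg_one_mul, abs_of_neg hv']⟩)
  -- Minus the difference of the two endpoint expansions, with the factor 1/n of the primitive.
  refine ⟨Polynomial.C (-((n : ℂ)⁻¹ * ((T ^ n)⁻¹ * (‖T‖ : ℂ) ^ n))) *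
    (Q.comp (Polynomial.C (‖T‖ : ℂ)⁻¹ * Polynomial.X) - Polynomial.C ((-1) ^ n) *
      Q.comp (Polynomial.C (-(‖T‖ : ℂ)⁻¹) * Polynomial.X)), ?_, ?_⟩
  · refine lt_of_le_of_lt ?_ (Polynomial.degree_sub_comp_lt hQ (‖T‖ : ℂ)⁻¹)
    rw [Polynomial.C_mul']
    exact Polynomial.degree_smul_le _ _
  · have hlim := (ka.sub kb).const_mul (n : ℂ)⁻¹
    rw [sub_zero, mul_zero] at hlim
    refine hlim.congr' ?_
    filter_upwards [hav, ha self_mem_nhdsWithin, hb self_mem_nhdsWithin] with v hv hv1 hv2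
    rw [h1.integral_inv_pow hn hv1 hv2 hv.2.2]
    simp only [Polynomial.eval_mul, Polynomial.eval_sub, Polynomial.eval_C, Polynomial.eval_comp,
      Polynomial.eval_X]
    push_cast
    have e1 : (1 : ℂ) * (v / ‖T‖) = (‖T‖ : ℂ)⁻¹ * v := by ring
    have e2 : (-1 : ℂ) * (v / ‖T‖) = -(‖T‖ : ℂ)⁻¹ * v := by ring
    rw [e1, e2, one_mul, mul_pow (-1 : ℂ)]
    ring

end IsSmoothClosedContour

/-! ### Taylor coefficients and change of base point -/

/-- Each divided difference at `t` shifts the power series there by one coefficient. -/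
theorem iterate_dslope_apply_self {x : ℂ → ℂ} {t : ℂ} (hx : AnalyticAt ℂ x t) (k : ℕ) :
    ((Function.swap dslope t)^[k] x) t = iteratedDeriv k x t / (k.factorial : ℂ) := by
  have h := hx.hasFPowerSeriesAt
  have h1 := (h.has_fpower_series_iterate_dslope_fslope k).coeff_zero 1
  rw [← h1, ← FormalMultilinearSeries.coeff, FormalMultilinearSeries.coeff_iterate_fslope, zero_add,
    FormalMultilinearSeries.coeff_ofScalars]

namespace IsSmoothClosedContour

variable {γ : ℝ → ℂ}

/-- Moves any point of the contour to parameter 0. Parameters with the same image differ by an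
integer, which is 0 within one half-open period. -/
theorem comp_add_const {n : ℕ} (h : IsSmoothClosedContour n γ) (c : ℝ) :
    IsSmoothClosedContour n (fun s => γ (s + c)) where
  periodic s := by
    have := h.periodic (s + c)
    rwa [show s + c + 1 = s + 1 + c by ring] at this
  contDiff := h.contDiff.comp (contDiff_id.add contDiff_const)
  deriv_ne_zero s := by
    rw [deriv_comp_add_const]
    exact h.deriv_ne_zero _
  injOn := by
    intro s hs s' hs' he
    have he' : γ (Int.fract (s + c)) = γ (Int.fract (s' + c)) := by
      rw [Int.fract, Int.fract, ← mul_one ((⌊s + c⌋ : ℤ) : ℝ), ← mul_one ((⌊s' + c⌋ : ℤ) : ℝ),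
        h.periodic.sub_int_mul_eq, h.periodic.sub_int_mul_eq]
      exact he
    have h1 := h.injOn ⟨Int.fract_nonneg _, Int.fract_lt_one _⟩
      ⟨Int.fract_nonneg _, Int.fract_lt_one _⟩ he'
    obtain ⟨z, hz⟩ := Int.fract_eq_fract.1 h1
    have h2 : s - s' = z := by linarith
    have h3 : |(z : ℝ)| < 1 := by
      rw [← h2, abs_lt]
      constructor <;> linarith [hs.1, hs.2, hs'.1, hs'.2]
    have h4 : z = 0 := Int.abs_lt_one_iff.1 (by exact_mod_cast h3)
    rw [h4, Int.cast_zero] at h2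
    linarith

end IsSmoothClosedContour

theorem range_comp_add_const (γ : ℝ → ℂ) (c : ℝ) : range (fun s => γ (s + c)) = range γ :=
  (Equiv.addRight c).surjective.range_comp γ

theorem Function.Periodic.integral_comp_add_const {f : ℝ → ℂ} (hf : Function.Periodic f 1) (c : ℝ) :
    ∫ s in (0 : ℝ)..1, f (s + c) = ∫ s in (0 : ℝ)..1, f s := by
  rw [intervalIntegral.integral_comp_add_right, zero_add, add_comm 1 c,
    hf.intervalIntegral_add_eq c 0, zero_add]

namespace IsSmoothClosedContour

variable {γ : ℝ → ℂ}

theorem isPositivelyOriented_comp_add_const (h : IsSmoothClosedContour 1 γ)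
    (ho : IsPositivelyOriented γ) (c : ℝ) : IsPositivelyOriented (fun s => γ (s + c)) := by
  intro z hz
  rw [innerDomain, range_comp_add_const] at hz
  rw [← ho z hz]
  simp only [deriv_comp_add_const]
  exact Function.Periodic.integral_comp_add_const (f := fun s => deriv γ s / (γ s - z))
    (fun s => by simp only [h.periodic s, h.periodic_deriv s]) c

theorem truncatedIntegral_comp_add_const (h : IsSmoothClosedContour 1 γ) (c : ℝ) (φ : ℂ → ℂ) (p : ℕ)
    (t : ℂ) (v : ℝ) :
    truncatedIntegral (fun s => γ (s + c)) φ p t v = truncatedIntegral γ φ p t v := by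
  have key : ∀ g : ℝ → ℂ, Continuous g → truncatedIntegral g φ p t v =
      ∫ s in (0 : ℝ)..1, {s | v < ‖g s - t‖}.indicator
        (fun s => φ (g s) / (g s - t) ^ p * deriv g s) s := by
    intro g hg
    have hm : MeasurableSet {s | v < ‖g s - t‖} :=
      (isOpen_lt continuous_const (hg.sub continuous_const).norm).measurableSet
    rw [intervalIntegral.integral_of_le zero_le_one, setIntegral_indicator hm]
    rfl
  have hc : Continuous fun s => γ (s + c) := h.continuous.comp (continuous_add_const c)
  rw [key _ hc, key _ h.continuous]
  have hper : Function.Periodic ({s | v < ‖γ s - t‖}.indicator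
      (fun s => φ (γ s) / (γ s - t) ^ p * deriv γ s)) 1 := by
    intro s
    simp only [indicator, mem_ofPred_eq, h.periodic s, h.periodic_deriv s]
  rw [← hper.integral_comp_add_const c]
  simp only [indicator, mem_ofPred_eq, deriv_comp_add_const]

theorem exists_truncatedIntegral_eq (h : IsSmoothClosedContour 1 γ) :
    ∃ a b : ℝ → ℝ, Tendsto a (𝓝[>] 0) (𝓝[>] 0) ∧ Tendsto b (𝓝[>] 0) (𝓝[<] 0) ∧
      ∀ᶠ v in 𝓝[>] (0 : ℝ), (‖γ (a v) - γ 0‖ = v ∧ ‖γ (b v) - γ 0‖ = v ∧ a v < 1 + b v) ∧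
        ∀ φ p, truncatedIntegral γ φ p (γ 0) v =
          ∫ s in a v..1 + b v, φ (γ s) / (γ s - γ 0) ^ p * deriv γ s := by
  obtain ⟨a, b, ha, hb, hab⟩ := h.exists_truncation_arc
  refine ⟨a, b, ha, hb, ?_⟩
  filter_upwards [hab] with v ⟨h1, h2, h3, h4⟩
  refine ⟨⟨h1, h2, h3⟩, fun φ p => ?_⟩
  rw [truncatedIntegral, h4, intervalIntegral.integral_of_le h3.le, integral_Ioc_eq_integral_Ioo]

/-! ### Evaluation of the hypersingular integrals -/

theorem truncated_split (h : IsSmoothClosedContour 1 γ) {U : Set ℂ} (hU : IsOpen U)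
    (hγU : range γ ⊆ U) {x : ℂ → ℂ} (hx : DifferentiableOn ℂ x U) (k : ℕ) {a b : ℝ} (ha : 0 < a)
    (hb : b < 0) (hab : a < 1 + b) :
    ∫ s in a..1 + b, x (γ s) / (γ s - γ 0) ^ (k + 1) * deriv γ s =
      x (γ 0) * (∫ s in a..1 + b, deriv γ s / (γ s - γ 0) ^ (k + 1)) +
        ∫ s in a..1 + b, dslope x (γ 0) (γ s) / (γ s - γ 0) ^ k * deriv γ s := by
  have hne : ∀ s ∈ uIcc a (1 + b), γ s - γ 0 ≠ 0 := fun s hs => by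
    rw [uIcc_of_le hab.le] at hs
    exact sub_ne_zero.2 (h.apply_ne_of_mem_Ioo ⟨ha.trans_le hs.1, by linarith [hs.2]⟩)
  have hpow : ∀ m, ContinuousOn (fun s => (γ s - γ 0) ^ m) (uIcc a (1 + b)) := fun m =>
    ((h.continuous.sub continuous_const).pow m).continuousOn
  have hds : ContinuousOn (fun s => dslope x (γ 0) (γ s)) (uIcc a (1 + b)) := by
    rw [uIcc_of_le hab.le]
    exact continuousOn_dslope_comp hU hx h.continuous (fun s _ => hγU ⟨s, rfl⟩) (hγU ⟨0, rfl⟩)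
  have hd := h.continuous_deriv.continuousOn (s := uIcc a (1 + b))
  rw [← intervalIntegral.integral_const_mul, ← intervalIntegral.integral_add]
  · refine intervalIntegral.integral_congr fun s hs => ?_
    have e1 := sub_smul_dslope x (γ 0) (γ s)
    rw [smul_eq_mul] at e1
    have e2 : x (γ s) = x (γ 0) + (γ s - γ 0) * dslope x (γ 0) (γ s) := by rw [e1]; ring
    have := hne s hs
    rw [e2]
    field_simp
    ring
  · exact (continuousOn_const.mul
      (hd.div (hpow (k + 1)) fun s hs => pow_ne_zero _ (hne s hs))).intervalIntegrable
  · exact ((hds.div (hpow k) fun s hs => pow_ne_zero _ (hne s hs)).mul hd).intervalIntegrable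

/-- Hypersingular integrals of a function that is holomorphic inside and on the contour. -/
theorem hasHypersingularIntegral_zero (k : ℕ) (h : IsSmoothClosedContour (k + 1) γ)
    (ho : IsPositivelyOriented γ) {U : Set ℂ} (hU : IsOpen U) (hγU : range γ ⊆ U)
    (hW : ∀ z ∉ U, windingIntegral γ z = 0) {x : ℂ → ℂ} (hx : DifferentiableOn ℂ x U) :
    HasHypersingularIntegral γ x (k + 1) (γ 0)
      (Real.pi * Complex.I * ((Function.swap dslope (γ 0))^[k] x) (γ 0)) := by
  induction k generalizing x with
  | zero =>
    have h1 : IsSmoothClosedContour 1 γ := h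
    obtain ⟨a, b, ha, hb, hab⟩ := h1.exists_truncatedIntegral_eq
    refine ⟨0, by simp, ?_⟩
    have hJ := (h1.tendsto_truncated_inv ho ha hb (hab.mono fun v hv => by
      rw [hv.1.1, hv.1.2.1])).const_mul (x (γ 0))
    have hcont : Continuous fun s => dslope x (γ 0) (γ s) * deriv γ s := by
      refine Continuous.mul (continuous_iff_continuousAt.2 fun s => ?_) h1.continuous_deriv
      exact ((continuousOn_dslope_comp hU hx h1.continuous (a := s - 1) (b := s + 1)
        (fun s _ => hγU ⟨s, rfl⟩) (hγU ⟨0, rfl⟩))).continuousAt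
          (Icc_mem_nhds (by linarith) (by linarith))
    have hR : Tendsto (fun v => ∫ s in a v..1 + b v, dslope x (γ 0) (γ s) * deriv γ s)
        (𝓝[>] 0) (𝓝 0) := by
      have hprim := intervalIntegral.continuous_primitive
        (fun c d => hcont.intervalIntegrable c d) 0 (μ := volume)
      have e1 := (hprim.tendsto 0).comp (tendsto_nhds_of_tendsto_nhdsWithin ha)
      have hb1 : Tendsto (fun v => 1 + b v) (𝓝[>] 0) (𝓝 1) := by
        simpa using (tendsto_nhds_of_tendsto_nhdsWithin hb).const_add 1
      have e2 := (hprim.tendsto 1).comp hb1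
      have e3 := e2.sub e1
      -- The regular remainder tends to its integral over the full contour, which Cauchy's theorem
      -- makes 0.
      rw [h1.integral_dslope_eq_zero hU hγU hW hx (hγU ⟨0, rfl⟩), intervalIntegral.integral_same,
        sub_zero] at e3
      refine e3.congr fun v => ?_
      exact intervalIntegral.integral_interval_sub_left (hcont.intervalIntegrable _ _)
        (hcont.intervalIntegrable _ _)
    have hlim := hJ.add hR
    rw [add_zero] at hlim
    simp only [Function.iterate_zero, id]
    rw [mul_comm]
    refine hlim.congr' ?_
    filter_upwards [hab, ha self_mem_nhdsWithin, hb self_mem_nhdsWithin] with v hv hv1 hv2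
    rw [hv.2, h1.truncated_split hU hγU hx 0 hv1 hv2 hv.1.2.2]
    simp
  | succ k ih =>
    have h1 : IsSmoothClosedContour 1 γ := h.mono (by omega)
    obtain ⟨a, b, ha, hb, hab⟩ := h1.exists_truncatedIntegral_eq
    have hdx : DifferentiableOn ℂ (dslope x (γ 0)) U :=
      (Complex.differentiableOn_dslope (hU.mem_nhds (hγU ⟨0, rfl⟩))).2 hx
    obtain ⟨η, hη, hηt⟩ := ih (h.mono (by omega)) hdx
    obtain ⟨ξ, hξ, hξt⟩ := h.exists_polynomial_tendsto_integral_inv_pow k.succ_ne_zero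
      ha hb (hab.mono fun v hv => hv.1)
    rw [Nat.succ_eq_add_one] at hξ hξt
    simp only [Nat.add_sub_cancel] at hη hηt ⊢
    -- The factor X compensates for the denominator, which rises from v^k to v^(k+1).
    refine ⟨Polynomial.C (x (γ 0)) * ξ + Polynomial.X * η, ?_, ?_⟩
    · rw [Nat.add_sub_cancel]
      refine (Polynomial.degree_add_le _ _).trans_lt (max_lt ?_ ?_)
      · rw [Polynomial.C_mul']
        exact (Polynomial.degree_smul_le _ _).trans_lt hξ
      · rw [Polynomial.degree_lt_iff_coeff_zero] at hη ⊢
        intro m hm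
        obtain ⟨m, rfl⟩ : ∃ j, m = j + 1 := ⟨m - 1, by omega⟩
        rw [Polynomial.coeff_X_mul]
        exact hη m (by omega)
    · have hlim := (hξt.const_mul (x (γ 0))).add hηt
      rw [mul_zero, zero_add] at hlim
      rw [Function.iterate_succ_apply]
      refine hlim.congr' ?_
      filter_upwards [hab, ha self_mem_nhdsWithin, hb self_mem_nhdsWithin,
        self_mem_nhdsWithin] with v hv hv1 hv2 hv3
      have hv0 : (v : ℂ) ≠ 0 := Complex.ofReal_ne_zero.2 (ne_of_gt hv3)
      rw [hv.2, hv.2, h1.truncated_split hU hγU hx (k + 1) hv1 hv2 hv.1.2.2, Nat.add_sub_cancel]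
      simp only [Polynomial.eval_add, Polynomial.eval_mul, Polynomial.eval_C, Polynomial.eval_X]
      have e : (v : ℂ) * η.eval (v : ℂ) / (v : ℂ) ^ (k + 1) = η.eval (v : ℂ) / (v : ℂ) ^ k := by
        rw [pow_succ']
        exact mul_div_mul_left _ _ hv0
      rw [add_div, e]
      ring

/-- The open set for Cauchy's theorem is the set of all points of analyticity of `x`; it contains
the contour and its interior, so the winding integral vanishes off it. -/
theorem hasHypersingularIntegral (k : ℕ) (h : IsSmoothClosedContour (k + 1) γ)
    (ho : IsPositivelyOriented γ) {x : ℂ → ℂ} (hx : AnalyticOnNhd ℂ x (range γ ∪ innerDomain γ))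
    {t : ℂ} (ht : t ∈ range γ) :
    HasHypersingularIntegral γ x (k + 1) t
      (Real.pi * Complex.I * (iteratedDeriv k x t / (k.factorial : ℂ))) := by
  obtain ⟨c, rfl⟩ := ht
  have h1 : IsSmoothClosedContour 1 γ := h.mono (by omega)
  have hγU : range γ ⊆ {z | AnalyticAt ℂ x z} := fun z hz => hx z (Or.inl hz)
  have hr := range_comp_add_const γ c
  have key := (h.comp_add_const c).hasHypersingularIntegral_zero k
    (h1.isPositivelyOriented_comp_add_const ho c) (isOpen_analyticAt ℂ x) (by rwa [hr])
    (fun z hz => (h1.comp_add_const c).windingIntegral_eq_zero fun hmem => hz (hx z (by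
      rwa [innerDomain, hr] at hmem)))
    (fun z hz => AnalyticAt.differentiableWithinAt hz)
  simp only [zero_add] at key
  rw [iterate_dslope_apply_self (hγU ⟨c, rfl⟩)] at key
  obtain ⟨ξ, hξ, hlim⟩ := key
  refine ⟨ξ, hξ, hlim.congr fun v => ?_⟩
  rw [h1.truncatedIntegral_comp_add_const]

end IsSmoothClosedContour

/-! ### Equivalence of the two equations -/

theorem mainTheorem4 (p : ℕ) [NeZero p] (γ : ℝ → ℂ) (hγ : IsSmoothClosedContour p γ)
    (horient : IsPositivelyOriented γ)
    (G : Set ℂ) (hG : Set.range γ ∪ innerDomain γ ⊆ G)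
    (F : (Fin p → Set.range γ → ℂ) → (Set.range γ → ℂ) → (Set.range γ → ℂ))
    (f : Set.range γ → ℂ) :
    {x : ℂ → ℂ | AnalyticOnNhd ℂ x G ∧ SolvesHypersingularEq γ F f x} =
      {x : ℂ → ℂ | AnalyticOnNhd ℂ x G ∧ SolvesDifferentialEq (differentialOperator F) f x} := by
  ext x
  simp only [mem_ofPred_eq]
  refine and_congr_right fun hx => ?_
  have hI : ∀ (j : Fin p) (t : Set.range γ), HasHypersingularIntegral γ x (j + 1) t
      (Real.pi * Complex.I * (iteratedDeriv j x t / (Nat.factorial j : ℂ))) := fun j t =>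
    (hγ.mono j.is_lt).hasHypersingularIntegral j horient (hx.mono hG) t.2
  have hπ : (Real.pi : ℂ) * Complex.I ≠ 0 :=
    mul_ne_zero (Complex.ofReal_ne_zero.2 Real.pi_ne_zero) Complex.I_ne_zero
  have hop : differentialOperator F (fun j t => iteratedDeriv j x t) =
      F (fun j t => 1 / (Real.pi * Complex.I) *
        (Real.pi * Complex.I * (iteratedDeriv j x t / (Nat.factorial j : ℂ)))) (fun t => x t) := by
    rw [differentialOperator]
    congr 1
    funext j t
    rw [one_div, inv_mul_cancel_left₀ hπ]
  rw [SolvesDifferentialEq, hop]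
  constructor
  -- Whatever values `I` are supplied, uniqueness identifies them with the computed ones.
  · rintro ⟨I, hII, hF⟩
    rw [← hF]
    congr 1
    funext j t
    rw [(hII j t).unique (hI j t)]
  · intro hF
    exact ⟨_, hI, hF⟩
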